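/- Let $M,n\ge 0$ be integers, $N=2n$ and $K=M+N$. Put $[a]=0$ for $1\le a\le M$ and $[a]=1$ for $M+1\le a\le K$. The superYangian $Y(M|N)$ is the unital associative $\mathbb C$-algebra with generators $T^{ab}_{(p)}$ ($p\ge 0$, $1\le a,b\le K$), $T^{ab}_{(0)}=\delta_{ab}$, of parity $[a]+[b]$, whose series $T^{ab}(u)=\sum_{p\ge0}T^{ab}_{(p)}u^{-p}$ satisfy $$(u-v)\,[T^{ab}(u),T^{cd}(v)\}=(-1)^{[a][b]+([a]+[b])[c]}\bigl(T^{cb}(u)T^{ad}(v)-T^{cb}(v)T^{ad}(u)\bigr),$$ where $[X,Y\}=XY-(-1)^{[X][Y]}YX$. Put $\bar a=M+1-a$ for $a\le M$ and $\bar a=2M+N+1-a$ for $a>M$. Let $\theta_1,\dots,\theta_K\in\{1,-1\}$ be any signs with $(-1)^{[a]}\theta_a\theta_{\bar a}=1$ for all $a$, set $\tau(T^{ab}(u))=(-1)^{[a]([b]+1)}\theta_a\theta_b\,T^{\bar b\bar a}(-u)$, and let $$S^{ab}(u)=\sum_{c=1}^{K}T^{ac}(u)\,\tau(T^{cb}(u))=\sum_{p\ge0}S^{ab}_{(p)}u^{-p}.$$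 The twisted superYangian $Y(M|2n)^\tau$ is the unital subalgebra of $Y(M|2n)$ generated by all $S^{ab}_{(p)}$. Theorem (PBW basis for $Y(M|2n)^\tau$). Fix an arbitrary linear order on the following set of generators, where $p$ runs over the integers $p\ge1$: - $S^{ij}_{(p)}$, $p$ even, $1\le i,j\le M$, $i+j\le M+1$; - $S^{ij}_{(p)}$, $p$ odd, $1\le i,j\le M$, $i+j<M+1$; - $S^{ij}_{(p)}$, $p$ even, $M+1\le i,j\le M+2n$, $i+j<2M+2n+1$; - $S^{ij}_{(p)}$, $p$ odd, $M+1\le i,j\le M+2n$, $i+j\le 2M+2n+1$; - $S^{ij}_{(p)}$, all $p\geq 1$, $M+1\le i\le M+2n$, $1\le j\le M$. Then every element of $Y(M|2n)^\tau$ can be written uniquely as a complex linear combination of the ordered monomials in these generators, where an ordered monomial is a finite product of generators taken in increasing order, the even generators ($[i]=[j]$) with arbitrary non-negative exponents and the odd generators ($[i]\ne[j]$) with exponents $0$ or $1$. That is, these ordered monomials form a basis of $Y(M|2n)^\tau$. -/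

import Mathlib

namespace TwistedSuperYangian

/-- The `ℤ/2`-grade of an index: the first `M` indices are even, the last `N` are odd.
The one-based index `a` of the text is the element of `Fin (M + N)` with value `a - 1`. -/
def parity {M N : ℕ} (a : Fin (M + N)) : ℕ := if a.val < M then 0 else 1

/-- Relations of the superYangian `Y(M|N)` on letters `T^{ab}_{(p)}`, written `(p, a, b)`. -/
inductive Rel (M N : ℕ) :
    FreeAlgebra ℂ (ℕ × Fin (M + N) × Fin (M + N)) →
    FreeAlgebra ℂ (ℕ × Fin (M + N) × Fin (M + N)) → Prop
  /-- `T^{ab}_{(0)} = δ_{ab}`. -/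
  | zero (a b : Fin (M + N)) :
      Rel M N (FreeAlgebra.ι ℂ (0, a, b)) (if a = b then 1 else 0)
  /-- The coefficient of `u^{-p} v^{-q}` in
  `(u - v) [T^{ab}(u), T^{cd}(v)} = ± (T^{cb}(u) T^{ad}(v) - T^{cb}(v) T^{ad}(u))`,
  with sign `(-1)^{[a][b] + ([a] + [b])[c]}` and the graded commutator on the left. -/
  | comm (p q : ℕ) (a b c d : Fin (M + N)) :
      Rel M N
        ((FreeAlgebra.ι ℂ (p + 1, a, b) * FreeAlgebra.ι ℂ (q, c, d)
            - (-1 : ℂ) ^ ((parity a + parity b) * (parity c + parity d)) •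
              (FreeAlgebra.ι ℂ (q, c, d) * FreeAlgebra.ι ℂ (p + 1, a, b)))
          - (FreeAlgebra.ι ℂ (p, a, b) * FreeAlgebra.ι ℂ (q + 1, c, d)
            - (-1 : ℂ) ^ ((parity a + parity b) * (parity c + parity d)) •
              (FreeAlgebra.ι ℂ (q + 1, c, d) * FreeAlgebra.ι ℂ (p, a, b))))
        ((-1 : ℂ) ^ (parity a * parity b + (parity a + parity b) * parity c) •
          (FreeAlgebra.ι ℂ (p, c, b) * FreeAlgebra.ι ℂ (q, a, d)
            - FreeAlgebra.ι ℂ (q, c, b) * FreeAlgebra.ι ℂ (p, a, d)))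

/-- The superYangian `Y(M|N)` of `gl(M|N)`. -/
def SuperYangian (M N : ℕ) : Type := RingQuot (Rel M N)

noncomputable instance (M N : ℕ) : Ring (SuperYangian M N) :=
  inferInstanceAs (Ring (RingQuot (Rel M N)))

noncomputable instance (M N : ℕ) : Algebra ℂ (SuperYangian M N) :=
  inferInstanceAs (Algebra ℂ (RingQuot (Rel M N)))

/-- The generator `T^{ab}_{(p)}` of `Y(M|N)`. -/
noncomputable def T {M N : ℕ} (p : ℕ) (a b : Fin (M + N)) : SuperYangian M N :=
  RingQuot.mkAlgHom ℂ (Rel M N) (FreeAlgebra.ι ℂ (p, a, b))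

/-- The involution `a ↦ ā` of the indices; in one-based indices `ā = M + 1 - a` for
`1 ≤ a ≤ M` and `ā = 2M + N + 1 - a` for `M + 1 ≤ a ≤ M + N`. -/
def bar {M N : ℕ} (a : Fin (M + N)) : Fin (M + N) :=
  if h : a.val < M then ⟨M - 1 - a.val, by omega⟩
  else ⟨2 * M + N - 1 - a.val, by have := a.isLt; omega⟩

/-- Admissible signs for the twist with `θ₀ = 1`:
`θ_a = ±1` and `(-1)^{[a]} θ_a θ_ā = 1` for every `a`. -/
def IsTwist {M N : ℕ} (θ : Fin (M + N) → ℂ) : Prop :=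
  ∀ a, (θ a = 1 ∨ θ a = -1) ∧ (-1 : ℂ) ^ parity a * θ a * θ (bar a) = 1

/-- The coefficient of `u^{-p}` in
`τ(T^{ab}(u)) = (-1)^{[a]([b] + 1)} θ_a θ_b T^{b̄ā}(-u)`. -/
noncomputable def tauT {M N : ℕ} (θ : Fin (M + N) → ℂ) (p : ℕ) (a b : Fin (M + N)) :
    SuperYangian M N :=
  ((-1 : ℂ) ^ (parity a * (parity b + 1)) * θ a * θ b * (-1) ^ p) • T p (bar b) (bar a)

/-- `S^{ab}_{(p)}`: the coefficient of `u^{-p}` in the entry `(a, b)` of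
`S(u) = T(u) τ[T(u)]`. -/
noncomputable def S {M N : ℕ} (θ : Fin (M + N) → ℂ) (p : ℕ) (a b : Fin (M + N)) :
    SuperYangian M N :=
  ∑ c, ∑ k ∈ Finset.range (p + 1), T (p - k) a c * tauT θ k c b

/-- The twisted superYangian: the unital subalgebra of `Y(M|N)` generated by all
the coefficients `S^{ab}_{(p)}`. -/
noncomputable def twisted {M N : ℕ} (θ : Fin (M + N) → ℂ) :
    Subalgebra ℂ (SuperYangian M N) :=
  Algebra.adjoin ℂ {x | ∃ (p : ℕ) (a b : Fin (M + N)), x = S θ p a b}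

/-- The index conditions for the PBW generators `S^{ij}_{(p)}` of `Y(M|2n)^τ`, in the
one-based indices `i, j ∈ {1, …, M + 2n}`. -/
def IsPBWIndex (M n p i j : ℕ) : Prop :=
  (i ≤ M ∧ j ≤ M ∧ Even p ∧ i + j ≤ M + 1) ∨
  (i ≤ M ∧ j ≤ M ∧ Odd p ∧ i + j < M + 1) ∨
  (M + 1 ≤ i ∧ M + 1 ≤ j ∧ Even p ∧ i + j < 2 * M + 2 * n + 1) ∨
  (M + 1 ≤ i ∧ M + 1 ≤ j ∧ Odd p ∧ i + j ≤ 2 * M + 2 * n + 1) ∨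
  (M + 1 ≤ i ∧ j ≤ M)

/-- The labels `(p, i, j)` of the PBW generators `S^{ij}_{(p)}`, `p ≥ 1`. -/
structure PBWLabel (M n : ℕ) where
  p : ℕ
  i : Fin (M + 2 * n)
  j : Fin (M + 2 * n)
  pos : 1 ≤ p
  mem : IsPBWIndex M n p (i.val + 1) (j.val + 1)

/-- Exponents of ordered monomials: finitely supported, and at most `1` on the odd
generators, those with `[i] ≠ [j]`. -/
def PBWExponent (M n : ℕ) : Type :=
  {f : PBWLabel M n →₀ ℕ // ∀ x, parity x.i ≠ parity x.j → f x ≤ 1}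

/-- The ordered monomial with a given exponent: the product, in increasing order of the
labels `x`, of the powers of the generators `S_x`. -/
noncomputable def orderedMonomial {M n : ℕ} [LinearOrder (PBWLabel M n)]
    (θ : Fin (M + 2 * n) → ℂ) (f : PBWExponent M n) : SuperYangian M (2 * n) :=
  ((f.1.support.sort (· ≤ ·)).map fun x => S θ x.p x.i x.j ^ f.1 x).prod

end TwistedSuperYangian

/-! Algebraic input. In matrix form the relations of Y(M|N) read R(u-v) T₁(u) T₂(v) = T₂(v) T₁(u)
R(u-v). With central variables x = u⁻¹, y = v⁻¹ and all denominators cleared by xy, this is an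
identity of matrices over power series. Transposing one tensor factor gives τT₁ R' T₂ = T₂ R' τT₁.
Since R and R' commute, S = T τ(T) satisfies the reflection equation (`reflection`). Putting u = v
in the mixed relation gives `symmetry`: S^{ab}_{(p)} equals a sign times S^{b̄ā}_{(p)} modulo a
multiple of S^{ab}_{(p-1)}.

Spanning. Give S_{(p)} weight p. By the reflection equation supercommutators lose one unit of
weight, so generators may be reordered modulo lower weight. The square of an odd generator is half
its supercommutator with itself, hence also lower. The symmetry relation leaves one generator for
each orbit of (a,b) ↦ (b̄,ā), and disposes of the fixed points on which the sign is -1. Induction on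
the weight gives `filtS_le_span`.

Independence. No PBW theorem for Y(M|N) is used; the proof builds operators that behave like partial
derivatives. The coproduct followed by the evaluation representation of parameter z maps Y(M|N) to
polynomials in z with coefficients in matrices over Y(M|N). Let `delta` be this map minus the
trivial action. Give T_{(p)} weight 2p-1 and z weight 2. Then `delta` lowers weight by one, is a
graded derivation up to a term one step lower still, and sends T^{ab}_{(p+1)} to ±z^p E_{ab} plus
lower terms. The products T_{(r)} T_{(s)} with r+s = p and r, s ≥ 1 have weight only 2p-2, so
S^{ab}_{(p)} has leading part T^{ab}_{(p)} ± T^{b̄ā}_{(p)}. Hence the coefficient of z^{p-1} E_{ij}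
in `delta` acts on ordered monomials, modulo lower weight, as a nonzero multiple of ∂/∂S^{ij}_{(p)}.
Differentiating a supposed relation repeatedly brings it down to weight zero, where it would say
that a nonzero scalar vanishes in Y(M|N) (`mon_independent_mod`). -/

set_option linter.unusedSectionVars false
set_option linter.unusedSimpArgs false
set_option linter.flexible false

noncomputable section

namespace TwistedSuperYangian

open PowerSeries

/-! ### Power series in the two spectral variables -/

section BivariateSeries

variable {C : Type*} [Ring C] [Algebra ℂ C]

/-- Formal power series in two central variables `x = u⁻¹` (inner) and `y = v⁻¹` (outer). -/
abbrev Bi (C : Type*) [Ring C] : Type _ := PowerSeries (PowerSeries C)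

/-- A series, regarded as a series in `x`. -/
def inU : PowerSeries C →+* Bi C := PowerSeries.C

/-- A series, regarded as a series in `y`. -/
def inV : PowerSeries C →+* Bi C := PowerSeries.map PowerSeries.C

/-- The variable `x`. -/
def xvar : Bi C := PowerSeries.C PowerSeries.X

/-- The variable `y`. -/
def yvar : Bi C := PowerSeries.X

/-- The coefficient of `x ^ p * y ^ q`. -/
def cf (p q : ℕ) : Bi C →ₗ[ℂ] C where
  toFun F := coeff p (coeff q F)
  map_add' := by simp
  map_smul' := by simp

theorem bi_ext {F G : Bi C} (h : ∀ p q, cf p q F = cf p q G) : F = G := by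
  ext q p
  exact h p q

theorem cf_inU_mul_inV (p q : ℕ) (f g : PowerSeries C) :
    cf p q (inU f * inV g) = coeff p f * coeff q g := by
  simp [cf, inU, inV, PowerSeries.coeff_C_mul, PowerSeries.coeff_mul_C]

theorem cf_inV_mul_inU (p q : ℕ) (f g : PowerSeries C) :
    cf p q (inV g * inU f) = coeff q g * coeff p f := by
  simp [cf, inU, inV, PowerSeries.coeff_C_mul, PowerSeries.coeff_mul_C]

theorem xvar_commute (F : Bi C) : Commute xvar F := by
  refine bi_ext fun p q => ?_
  simp only [cf, xvar, LinearMap.coe_mk, AddHom.coe_mk, PowerSeries.coeff_C_mul,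
    PowerSeries.coeff_mul_C]
  rw [(PowerSeries.commute_X _).eq]

theorem yvar_commute (F : Bi C) : Commute yvar F := (PowerSeries.commute_X F).symm

@[simp] theorem cf_succ_xvar_mul (p q : ℕ) (F : Bi C) :
    cf (p + 1) q (xvar * F) = cf p q F := by
  simp [cf, xvar, PowerSeries.coeff_C_mul, PowerSeries.coeff_succ_X_mul]

@[simp] theorem cf_zero_xvar_mul (q : ℕ) (F : Bi C) : cf 0 q (xvar * F) = 0 := by
  simp [cf, xvar, PowerSeries.coeff_C_mul]

@[simp] theorem cf_succ_yvar_mul (p q : ℕ) (F : Bi C) :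
    cf p (q + 1) (yvar * F) = cf p q F := by
  simp [cf, yvar, PowerSeries.coeff_succ_X_mul]

@[simp] theorem cf_zero_yvar_mul (p : ℕ) (F : Bi C) : cf p 0 (yvar * F) = 0 := by
  simp [cf, yvar]

/-- Dictionary between series and coefficients: s = -1 encodes multiplication by u - v and s = 1 by
u + v, both cleared by xy. The two vanishing conditions are the coefficients in which the right side
has no term. -/
theorem linear_mul_eq_iff {s : ℂ} (hs : s ≠ 0) (F G : Bi C) :
    yvar * F + s • (xvar * F) = xvar * (yvar * G) ↔
      (∀ q, cf 0 q F = 0) ∧ (∀ p, cf p 0 F = 0) ∧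
        ∀ p q, cf (p + 1) q F + s • cf p (q + 1) F = cf p q G := by
  constructor
  · intro h
    refine ⟨fun q => ?_, fun p => ?_, fun p q => ?_⟩
    · simpa using congrArg (cf 0 (q + 1)) h
    · simpa [hs] using congrArg (cf (p + 1) 0) h
    · simpa using congrArg (cf (p + 1) (q + 1)) h
  · rintro ⟨h0, h1, h2⟩
    refine bi_ext fun p q => ?_
    rcases p with _ | p <;> rcases q with _ | q <;> simp [h0, h1, h2]

end BivariateSeries

/-! ### The defining relations as an RTT equation -/

section MatrixForm

variable {M N : ℕ} {C : Type*} [Ring C] [Algebra ℂ C]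

theorem parity_eq (a : Fin (M + N)) : parity a = 0 ∨ parity a = 1 := by
  unfold parity; split_ifs <;> simp

/-- Matrices of size `K ^ 2`, acting on the tensor square of the vector representation. -/
abbrev BiMat (M N : ℕ) (C : Type*) [Ring C] : Type _ :=
  Matrix (Fin (M + N) × Fin (M + N)) (Fin (M + N) × Fin (M + N)) (Bi C)

/-- A matrix in the variable `x` acting on the first tensor factor, with the sign of the
graded tensor product. -/
def legOne (A : Matrix (Fin (M + N)) (Fin (M + N)) (PowerSeries C)) : BiMat M N C :=
  .of fun i j => if i.2 = j.2 then
    (-1 : ℂ) ^ ((parity i.1 + parity j.1) * parity i.2) • inU (A i.1 j.1) else 0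

/-- A matrix in the variable `y` acting on the second tensor factor. -/
def legTwo (A : Matrix (Fin (M + N)) (Fin (M + N)) (PowerSeries C)) : BiMat M N C :=
  .of fun i j => if i.1 = j.1 then inV (A i.2 j.2) else 0

theorem legOne_mul_legTwo (A A' : Matrix (Fin (M + N)) (Fin (M + N)) (PowerSeries C))
    (i j : Fin (M + N) × Fin (M + N)) :
    (legOne A * legTwo A') i j = (-1 : ℂ) ^ ((parity i.1 + parity j.1) * parity i.2) •
      (inU (A i.1 j.1) * inV (A' i.2 j.2)) := by
  rw [Matrix.mul_apply, Finset.sum_eq_single (j.1, i.2)]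
  · simp [legOne, legTwo]
  · rintro ⟨k, l⟩ - h
    by_cases h1 : i.2 = l
    · have : k ≠ j.1 := by rintro rfl; exact h (by rw [h1])
      simp [legTwo, this]
    · simp [legOne, h1]
  · simp

theorem legTwo_mul_legOne (A A' : Matrix (Fin (M + N)) (Fin (M + N)) (PowerSeries C))
    (i j : Fin (M + N) × Fin (M + N)) :
    (legTwo A' * legOne A) i j = (-1 : ℂ) ^ ((parity i.1 + parity j.1) * parity j.2) •
      (inV (A' i.2 j.2) * inU (A i.1 j.1)) := by
  rw [Matrix.mul_apply, Finset.sum_eq_single (i.1, j.2)]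
  · simp [legOne, legTwo]
  · rintro ⟨k, l⟩ - h
    by_cases h1 : i.1 = k
    · have : l ≠ j.2 := by rintro rfl; exact h (by rw [h1])
      simp [legOne, this]
    · simp [legTwo, h1]
  · simp

theorem neg_one_pow_add_mul (a b c d : ℕ) :
    (-1 : ℂ) ^ ((a + b) * d) * (-1) ^ ((b + c) * d) = (-1) ^ ((a + c) * d) := by
  rw [← pow_add]
  apply neg_one_pow_congr
  simp only [Nat.even_add, Nat.even_mul]
  tauto

theorem legOne_mul (A A' : Matrix (Fin (M + N)) (Fin (M + N)) (PowerSeries C)) :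
    legOne (A * A') = legOne A * legOne A' := by
  ext1 i j
  rw [Matrix.mul_apply, Fintype.sum_prod_type]
  by_cases h : i.2 = j.2
  · simp only [legOne, Matrix.of_apply, h, if_true, ite_mul, zero_mul, Finset.sum_ite_eq,
      Finset.mem_univ, Matrix.mul_apply, map_sum, map_mul, Finset.smul_sum,
      smul_mul_smul_comm, neg_one_pow_add_mul]
  · simp only [legOne, Matrix.of_apply, h, if_false, ite_mul, zero_mul, Finset.sum_ite_eq,
      Finset.mem_univ, mul_zero, if_true, Finset.sum_const_zero]

theorem legTwo_mul (A A' : Matrix (Fin (M + N)) (Fin (M + N)) (PowerSeries C)) :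
    legTwo (A * A') = legTwo A * legTwo A' := by
  ext1 i j
  rw [Matrix.mul_apply, Fintype.sum_prod_type_right]
  by_cases h : i.1 = j.1
  · simp [legTwo, h, Matrix.mul_apply]
  · simp [legTwo, h]

/-- The variable `x`, as a scalar matrix. -/
def xmat : BiMat M N C := Matrix.diagonal fun _ => xvar

/-- The variable `y`, as a scalar matrix. -/
def ymat : BiMat M N C := Matrix.diagonal fun _ => yvar

theorem xmat_commute (F : BiMat M N C) : Commute xmat F := by
  ext1 i j
  simp [xmat, (xvar_commute (F i j)).eq]

theorem ymat_commute (F : BiMat M N C) : Commute ymat F := by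
  ext1 i j
  simp [ymat, (yvar_commute (F i j)).eq]

@[simp] theorem xmat_mul_apply (F : BiMat M N C) (i j : Fin (M + N) × Fin (M + N)) :
    (xmat * F : BiMat M N C) i j = xvar * F i j := by simp [xmat]

@[simp] theorem ymat_mul_apply (F : BiMat M N C) (i j : Fin (M + N) × Fin (M + N)) :
    (ymat * F : BiMat M N C) i j = yvar * F i j := by simp [ymat]

/-- The graded permutation of the tensor factors. -/
def permMat : BiMat M N C :=
  .of fun i j => if j = i.swap then algebraMap ℂ _ ((-1) ^ (parity i.1 * parity i.2)) else 0

theorem permMat_mul_apply (F : BiMat M N C) (i j : Fin (M + N) × Fin (M + N)) :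
    (permMat * F : BiMat M N C) i j = (-1 : ℂ) ^ (parity i.1 * parity i.2) • F i.swap j := by
  rw [Matrix.mul_apply, Finset.sum_eq_single i.swap]
  · simp [permMat, Algebra.smul_def]
  · intro k _ h
    simp [permMat, h]
  · simp

theorem mul_permMat_apply (F : BiMat M N C) (i j : Fin (M + N) × Fin (M + N)) :
    (F * permMat : BiMat M N C) i j = (-1 : ℂ) ^ (parity j.1 * parity j.2) • F i j.swap := by
  rw [Matrix.mul_apply, Finset.sum_eq_single j.swap]
  · simp only [permMat, Matrix.of_apply, Prod.swap_swap, if_true, Prod.fst_swap, Prod.snd_swap]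
    rw [← Algebra.commutes, Algebra.smul_def, mul_comm (parity j.2)]
  · intro k _ h
    have : j ≠ k.swap := by rintro rfl; exact h (by simp)
    simp [permMat, this]
  · simp

/-- The rational `R`-matrix, multiplied by `x * y`. -/
def rMat : BiMat M N C := ymat - xmat - xmat * (ymat * permMat)

/-- The matrix of generating series of a family of coefficients. -/
def genMat (t : ℕ → Fin (M + N) → Fin (M + N) → C) :
    Matrix (Fin (M + N)) (Fin (M + N)) (PowerSeries C) :=
  .of fun a b => PowerSeries.mk fun p => t p a b

@[simp] theorem coeff_genMat (t : ℕ → Fin (M + N) → Fin (M + N) → C) (p : ℕ)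
    (a b : Fin (M + N)) : coeff p (genMat t a b) = t p a b := by simp [genMat]

/-- A family of elements of an algebra satisfying the defining relations of `Y(M|N)`. -/
structure IsRTT (t : ℕ → Fin (M + N) → Fin (M + N) → C) : Prop where
  zero : ∀ a b, t 0 a b = if a = b then 1 else 0
  comm : ∀ p q a b c d,
    (t (p + 1) a b * t q c d
        - (-1 : ℂ) ^ ((parity a + parity b) * (parity c + parity d)) •
          (t q c d * t (p + 1) a b))
      - (t p a b * t (q + 1) c d
        - (-1 : ℂ) ^ ((parity a + parity b) * (parity c + parity d)) •
          (t (q + 1) c d * t p a b)) =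
    (-1 : ℂ) ^ (parity a * parity b + (parity a + parity b) * parity c) •
      (t p c b * t q a d - t q c b * t p a d)

theorem rMat_mul_eq_iff (F G : BiMat M N C) :
    rMat * F = G * rMat ↔
      ∀ i j, yvar * (F - G) i j + (-1 : ℂ) • (xvar * (F - G) i j) =
        xvar * (yvar * (permMat * F - G * permMat : BiMat M N C) i j) := by
  rw [← Matrix.ext_iff]
  refine forall₂_congr fun i j => ?_
  have e1 : G * rMat = ymat * G - xmat * G - xmat * (ymat * (G * permMat)) := by
    simp only [rMat, mul_sub]
    rw [(ymat_commute G).eq, (xmat_commute G).eq, ← mul_assoc G, ← (xmat_commute G).eq,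
      mul_assoc, ← mul_assoc G, ← (ymat_commute G).eq, mul_assoc ymat]
  rw [e1]
  simp only [rMat, sub_mul, mul_assoc, Matrix.sub_apply, xmat_mul_apply, ymat_mul_apply,
    mul_sub, neg_smul, one_smul]
  rw [← sub_eq_zero, ← sub_eq_zero (b := _ - _)]
  refine Eq.congr ?_ rfl
  abel

/-- The constant term of the series is the identity, which supercommutes with everything; this
discharges a boundary condition of `linear_mul_eq_iff`. -/
theorem zero_comm_aux {t t' : ℕ → Fin (M + N) → Fin (M + N) → C}
    (h : ∀ a b, t 0 a b = if a = b then 1 else 0) (q : ℕ) (i j : Fin (M + N) × Fin (M + N)) :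
    cf 0 q ((legOne (genMat t) * legTwo (genMat t') - legTwo (genMat t') * legOne (genMat t)) i j) = 0 := by
  rw [Matrix.sub_apply, legOne_mul_legTwo, legTwo_mul_legOne]
  simp only [map_sub, map_smul, cf_inU_mul_inV, cf_inV_mul_inU, coeff_genMat, h]
  split_ifs with h1
  · rw [h1]; simp [← two_mul, mul_assoc]
  · simp

theorem comm_zero_aux {t t' : ℕ → Fin (M + N) → Fin (M + N) → C}
    (h : ∀ a b, t' 0 a b = if a = b then 1 else 0) (p : ℕ) (i j : Fin (M + N) × Fin (M + N)) :
    cf p 0 ((legOne (genMat t) * legTwo (genMat t') - legTwo (genMat t') * legOne (genMat t)) i j) = 0 := by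
  rw [Matrix.sub_apply, legOne_mul_legTwo, legTwo_mul_legOne]
  simp only [map_sub, map_smul, cf_inU_mul_inV, cf_inV_mul_inU, coeff_genMat, h]
  split_ifs with h1
  · rw [h1]; simp
  · simp

theorem isRTT_iff (t : ℕ → Fin (M + N) → Fin (M + N) → C) :
    IsRTT t ↔ (∀ a b, t 0 a b = if a = b then 1 else 0) ∧
      rMat * (legOne (genMat t) * legTwo (genMat t)) = (legTwo (genMat t) * legOne (genMat t)) * rMat := by
  have key : (∀ a b, t 0 a b = if a = b then 1 else 0) →
      ((rMat * (legOne (genMat t) * legTwo (genMat t)) = (legTwo (genMat t) * legOne (genMat t)) * rMat) ↔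
      ∀ p q a b c d,
    (t (p + 1) a b * t q c d
        - (-1 : ℂ) ^ ((parity a + parity b) * (parity c + parity d)) •
          (t q c d * t (p + 1) a b))
      - (t p a b * t (q + 1) c d
        - (-1 : ℂ) ^ ((parity a + parity b) * (parity c + parity d)) •
          (t (q + 1) c d * t p a b)) =
    (-1 : ℂ) ^ (parity a * parity b + (parity a + parity b) * parity c) •
      (t p c b * t q a d - t q c b * t p a d)) := by
    intro h0
    rw [rMat_mul_eq_iff]
    simp only [linear_mul_eq_iff (neg_ne_zero.2 (one_ne_zero (α := ℂ))), zero_comm_aux h0,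
      comm_zero_aux h0, implies_true, true_and]
    have e : ∀ p q a b c d, (cf (p + 1) q ((legOne (genMat t) * legTwo (genMat t) -
          legTwo (genMat t) * legOne (genMat t)) (a, c) (b, d)) +
        (-1 : ℂ) • cf p (q + 1) ((legOne (genMat t) * legTwo (genMat t) -
          legTwo (genMat t) * legOne (genMat t)) (a, c) (b, d)) =
        cf p q ((permMat * (legOne (genMat t) * legTwo (genMat t)) -
          legTwo (genMat t) * legOne (genMat t) * permMat : BiMat M N C) (a, c) (b, d))) ↔
        (t (p + 1) a b * t q c d
        - (-1 : ℂ) ^ ((parity a + parity b) * (parity c + parity d)) •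
          (t q c d * t (p + 1) a b))
      - (t p a b * t (q + 1) c d
        - (-1 : ℂ) ^ ((parity a + parity b) * (parity c + parity d)) •
          (t (q + 1) c d * t p a b)) =
    (-1 : ℂ) ^ (parity a * parity b + (parity a + parity b) * parity c) •
      (t p c b * t q a d - t q c b * t p a d) := by
      intro p q a b c d
      simp only [Matrix.sub_apply, permMat_mul_apply, mul_permMat_apply, legOne_mul_legTwo,
        legTwo_mul_legOne, map_sub, map_smul, cf_inU_mul_inV, cf_inV_mul_inU, coeff_genMat,
        Prod.fst_swap, Prod.snd_swap]
      -- This is the sign carried by the entries of `legOne`; rescaling by it aligns the matrix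
      -- entry with the relation in components.
      have hs : ((-1 : ℂ) ^ ((parity a + parity b) * parity c)) ≠ 0 := by simp
      rw [← (smul_right_injective C hs).eq_iff]
      refine Eq.congr ?_ ?_
      · rcases parity_eq a with ha | ha <;> rcases parity_eq b with hb | hb <;>
          rcases parity_eq c with hc | hc <;> rcases parity_eq d with hd | hd <;>
          norm_num [ha, hb, hc, hd] <;> abel
      · rcases parity_eq a with ha | ha <;> rcases parity_eq b with hb | hb <;>
          rcases parity_eq c with hc | hc <;> rcases parity_eq d with hd | hd <;>
          norm_num [ha, hb, hc, hd] <;> abel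
    constructor
    · intro h p q a b c d
      exact (e p q a b c d).1 (h (a, c) (b, d) p q)
    · rintro h ⟨a, c⟩ ⟨b, d⟩ p q
      exact (e p q a b c d).2 (h p q a b c d)
  constructor
  · exact fun h => ⟨h.zero, (key h.zero).2 h.comm⟩
  · exact fun h => ⟨h.1, (key h.1).1 h.2⟩

end MatrixForm

end TwistedSuperYangian

namespace TwistedSuperYangian

open PowerSeries

/-! ### The twist τ is involutive and preserves the relations -/

section Twist

variable {M N : ℕ} {C : Type*} [Ring C] [Algebra ℂ C]

@[simp] theorem parity_bar (a : Fin (M + N)) : parity (bar a) = parity a := by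
  unfold parity bar
  have := a.isLt
  split_ifs with h1 h2 h2 <;> first | rfl | (simp at h2; omega)

@[simp] theorem bar_bar (a : Fin (M + N)) : bar (bar a) = a := by
  have := a.isLt
  ext
  unfold bar
  split_ifs with h1 h2 h2
  · simp; omega
  · simp at h2; omega
  · simp at h2; omega
  · simp; omega

theorem bar_inj {a b : Fin (M + N)} : bar a = bar b ↔ a = b :=
  ⟨fun h => by rw [← bar_bar a, h, bar_bar], fun h => by rw [h]⟩

/-- The bijection of the indices given by `bar`. -/
def barEquiv : Fin (M + N) ≃ Fin (M + N) := ⟨bar, bar, bar_bar, bar_bar⟩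

theorem IsTwist.bar_eq {θ : Fin (M + N) → ℂ} (hθ : IsTwist θ) (a : Fin (M + N)) :
    θ (bar a) = (-1) ^ parity a * θ a := by
  have h := (hθ a).2
  rcases (hθ a).1 with h1 | h1 <;> rcases parity_eq a with h2 | h2 <;>
    rw [h1, h2] at h ⊢ <;> norm_num at h ⊢ <;> first | linear_combination h | linear_combination -h

/-- The family `τ(t)`. -/
def tauFam (θ : Fin (M + N) → ℂ) (t : ℕ → Fin (M + N) → Fin (M + N) → C) (p : ℕ)
    (a b : Fin (M + N)) : C :=
  ((-1 : ℂ) ^ (parity a * (parity b + 1)) * θ a * θ b * (-1) ^ p) • t p (bar b) (bar a)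

theorem tauFam_tauFam {θ : Fin (M + N) → ℂ} (hθ : IsTwist θ)
    (t : ℕ → Fin (M + N) → Fin (M + N) → C) : tauFam θ (tauFam θ t) = t := by
  funext p a b
  simp only [tauFam, smul_smul, bar_bar, parity_bar, hθ.bar_eq]
  convert one_smul ℂ (t p a b)
  have : (-1 : ℂ) ^ p * (-1) ^ p = 1 := by rw [← mul_pow]; simp
  rcases (hθ a).1 with h1 | h1 <;> rcases parity_eq a with h2 | h2 <;>
  rcases (hθ b).1 with h3 | h3 <;> rcases parity_eq b with h4 | h4 <;>
  simp [h1, h2, h3, h4, this]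

/-- Exchanging the two generators in the relation reverses the products on the right. This is the
form that matches after τ has transposed the indices. -/
theorem IsRTT.comm_swap {t : ℕ → Fin (M + N) → Fin (M + N) → C} (ht : IsRTT t)
    (p q : ℕ) (a b c d : Fin (M + N)) :
    (t (p + 1) a b * t q c d
        - (-1 : ℂ) ^ ((parity a + parity b) * (parity c + parity d)) •
          (t q c d * t (p + 1) a b))
      - (t p a b * t (q + 1) c d
        - (-1 : ℂ) ^ ((parity a + parity b) * (parity c + parity d)) •
          (t (q + 1) c d * t p a b)) =
    (-1 : ℂ) ^ (parity c * parity d + (parity c + parity d) * parity b) •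
      (t q a d * t p c b - t p a d * t q c b) := by
  have h := ht.comm q p c d a b
  have hs : ((-1 : ℂ) ^ ((parity a + parity b) * (parity c + parity d))) ≠ 0 := by simp
  rw [← (smul_right_injective C hs).eq_iff] at h ⊢
  rcases parity_eq a with ha | ha <;> rcases parity_eq b with hb | hb <;>
    rcases parity_eq c with hc | hc <;> rcases parity_eq d with hd | hd <;>
    norm_num [ha, hb, hc, hd] at h ⊢ <;>
    first
    | linear_combination (norm := module) h
    | linear_combination (norm := module) (-1 : ℂ) • h

theorem IsRTT.tau {θ : Fin (M + N) → ℂ} (hθ : IsTwist θ)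
    {t : ℕ → Fin (M + N) → Fin (M + N) → C} (ht : IsRTT t) : IsRTT (tauFam θ t) where
  zero a b := by
    simp only [tauFam, ht.zero, bar_inj]
    by_cases h : a = b
    · subst h
      rcases (hθ a).1 with h1 | h1 <;> rcases parity_eq a with h2 | h2 <;> simp [h1, h2]
    · simp [h, Ne.symm h]
  comm p q a b c d := by
    have h := ht.comm_swap p q (bar b) (bar a) (bar d) (bar c)
    simp only [parity_bar] at h
    simp only [tauFam, smul_mul_smul_comm, smul_smul]
    simp only [smul_sub, smul_smul] at h ⊢
    rcases parity_eq a with ha | ha <;> rcases parity_eq b with hb | hb <;>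
      rcases parity_eq c with hc | hc <;> rcases parity_eq d with hd | hd <;>
      norm_num [ha, hb, hc, hd, pow_succ] at h ⊢ <;>
      first
      | linear_combination (norm := module) (θ a * θ b * θ c * θ d * (-1) ^ p * (-1) ^ q) • h
      | linear_combination (norm := module) (-(θ a * θ b * θ c * θ d * (-1) ^ p * (-1) ^ q)) • h

end Twist

end TwistedSuperYangian

namespace TwistedSuperYangian

open PowerSeries

/-! ### The transposed R-matrix and the mixed relation -/

section Reflection

variable {M N : ℕ} {C : Type*} [Ring C] [Algebra ℂ C]

/-- The partial transpose of the graded permutation, twisted by the signs `θ`. -/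
def qMat (θ : Fin (M + N) → ℂ) : BiMat M N C :=
  .of fun i j => if i.2 = bar i.1 ∧ j.2 = bar j.1 then
    algebraMap ℂ _ ((-1) ^ parity i.1 * θ i.1 * θ j.1) else 0

theorem qMat_mul_legTwo (θ : Fin (M + N) → ℂ)
    (A : Matrix (Fin (M + N)) (Fin (M + N)) (PowerSeries C)) (i j : Fin (M + N) × Fin (M + N)) :
    (qMat θ * legTwo A : BiMat M N C) i j = if i.2 = bar i.1 then
      ((-1 : ℂ) ^ parity i.1 * θ i.1 * θ j.1) • inV (A (bar j.1) j.2) else 0 := by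
  rw [Matrix.mul_apply, Finset.sum_eq_single (j.1, bar j.1)]
  · split_ifs with h <;> simp [qMat, legTwo, h, Algebra.smul_def]
  · rintro ⟨k, l⟩ - h
    by_cases h1 : k = j.1
    · have : l ≠ bar k := by rintro rfl; exact h (by rw [h1])
      simp [qMat, this]
    · simp [legTwo, h1]
  · simp

theorem legTwo_mul_qMat (θ : Fin (M + N) → ℂ)
    (A : Matrix (Fin (M + N)) (Fin (M + N)) (PowerSeries C)) (i j : Fin (M + N) × Fin (M + N)) :
    (legTwo A * qMat θ : BiMat M N C) i j = if j.2 = bar j.1 then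
      ((-1 : ℂ) ^ parity i.1 * θ i.1 * θ j.1) • inV (A i.2 (bar i.1)) else 0 := by
  rw [Matrix.mul_apply, Finset.sum_eq_single (i.1, bar i.1)]
  · split_ifs with h
    · simp only [qMat, legTwo, Matrix.of_apply, h, and_self, if_true]
      rw [← Algebra.commutes, Algebra.smul_def]
    · simp [qMat, legTwo, h]
  · rintro ⟨k, l⟩ - h
    by_cases h1 : i.1 = k
    · have : l ≠ bar k := by rintro rfl; exact h (by rw [h1])
      simp [qMat, this]
    · simp [legTwo, h1]
  · simp

theorem legOne_mul_qMat_mul_legTwo (θ : Fin (M + N) → ℂ)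
    (A A' : Matrix (Fin (M + N)) (Fin (M + N)) (PowerSeries C))
    (i j : Fin (M + N) × Fin (M + N)) :
    (legOne A * (qMat θ * legTwo A') : BiMat M N C) i j =
      ((-1 : ℂ) ^ ((parity i.1 + parity i.2) * parity i.2) *
        ((-1 : ℂ) ^ parity i.2 * θ (bar i.2) * θ j.1)) •
      (inU (A i.1 (bar i.2)) * inV (A' (bar j.1) j.2)) := by
  rw [Matrix.mul_apply, Finset.sum_eq_single (bar i.2, i.2)]
  · rw [qMat_mul_legTwo]
    simp only [legOne, Matrix.of_apply, if_true, bar_bar, smul_mul_smul_comm, parity_bar]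
  · rintro ⟨k, l⟩ - h
    rw [qMat_mul_legTwo]
    by_cases h1 : i.2 = l
    · have : l ≠ bar k := by rintro rfl; exact h (by rw [h1, bar_bar])
      simp [this]
    · simp [legOne, h1]
  · simp

theorem legTwo_mul_qMat_mul_legOne (θ : Fin (M + N) → ℂ)
    (A A' : Matrix (Fin (M + N)) (Fin (M + N)) (PowerSeries C))
    (i j : Fin (M + N) × Fin (M + N)) :
    (legTwo A' * qMat θ * legOne A : BiMat M N C) i j =
      (((-1 : ℂ) ^ parity i.1 * θ i.1 * θ (bar j.2)) *
        (-1 : ℂ) ^ ((parity j.2 + parity j.1) * parity j.2)) •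
      (inV (A' i.2 (bar i.1)) * inU (A (bar j.2) j.1)) := by
  rw [Matrix.mul_apply, Finset.sum_eq_single (bar j.2, j.2)]
  · rw [legTwo_mul_qMat]
    simp only [legOne, Matrix.of_apply, if_true, bar_bar, smul_mul_smul_comm, parity_bar]
  · rintro ⟨k, l⟩ - h
    rw [legTwo_mul_qMat]
    by_cases h1 : l = j.2
    · have : l ≠ bar k := by rintro rfl; exact h (by rw [← h1, bar_bar])
      simp [this]
    · simp [legOne, h1]
  · simp

/-- The rational `R'`-matrix at `-u-v`, multiplied by `x * y`. -/
def rMat' (θ : Fin (M + N) → ℂ) : BiMat M N C := xmat + ymat + xmat * (ymat * qMat θ)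

theorem IsTwist.mul_self {θ : Fin (M + N) → ℂ} (hθ : IsTwist θ) (a : Fin (M + N)) :
    θ a * θ a = 1 := by
  rcases (hθ a).1 with h | h <;> simp [h]

/-- `qMat` is supported on pairs (a, ā), a set stable under the swap, and the twist condition makes
the signs agree on both sides. It is what makes R and R' commute. -/
theorem permMat_commute_qMat {θ : Fin (M + N) → ℂ} (hθ : IsTwist θ) :
    Commute (permMat : BiMat M N C) (qMat θ) := by
  ext1 i j
  rw [permMat_mul_apply, mul_permMat_apply]
  simp only [qMat, Matrix.of_apply, Prod.fst_swap, Prod.snd_swap]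
  by_cases h1 : i.2 = bar i.1
  · by_cases h2 : j.2 = bar j.1
    · rw [if_pos ⟨by rw [h1, bar_bar], h2⟩, if_pos ⟨h1, by rw [h2, bar_bar]⟩, h1, h2,
        Algebra.smul_def, Algebra.smul_def, ← map_mul, ← map_mul]
      simp only [parity_bar, hθ.bar_eq]
      congr 1
      rcases parity_eq i.1 with ha | ha <;> rcases parity_eq j.1 with hb | hb <;> simp [ha, hb]
    · have h3 : j.1 ≠ bar j.2 := fun h => h2 (by rw [h, bar_bar])
      simp [h2, h3]
  · have h3 : i.1 ≠ bar i.2 := fun h => h1 (by rw [h, bar_bar])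
    simp [h1, h3]

theorem rMat_commute_rMat' {θ : Fin (M + N) → ℂ} (hθ : IsTwist θ) :
    Commute (rMat : BiMat M N C) (rMat' θ) := by
  have hx : ∀ F : BiMat M N C, Commute F xmat := fun F => (xmat_commute F).symm
  have hy : ∀ F : BiMat M N C, Commute F ymat := fun F => (ymat_commute F).symm
  unfold rMat rMat'
  refine Commute.sub_left (Commute.sub_left (ymat_commute _) (xmat_commute _)) ?_
  refine Commute.mul_left (xmat_commute _) (Commute.mul_left (ymat_commute _) ?_)
  exact ((hx _).add_right (hy _)).add_right
    ((hx _).mul_right ((hy _).mul_right (permMat_commute_qMat hθ)))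

theorem mul_rMat'_mul_eq_iff (θ : Fin (M + N) → ℂ) (A B : BiMat M N C) :
    A * rMat' θ * B = B * rMat' θ * A ↔
      ∀ i j, yvar * (A * B - B * A) i j + (1 : ℂ) • (xvar * (A * B - B * A) i j) =
        xvar * (yvar * (B * qMat θ * A - A * (qMat θ * B) : BiMat M N C) i j) := by
  have e : ∀ A B : BiMat M N C, A * rMat' θ * B =
      xmat * (A * B) + ymat * (A * B) + xmat * (ymat * (A * (qMat θ * B))) := by
    intro A B
    simp only [rMat', mul_add, add_mul]
    rw [← (xmat_commute A).eq, ← (ymat_commute A).eq, mul_assoc, mul_assoc]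
    congr 1
    rw [← mul_assoc A, ← (xmat_commute A).eq, mul_assoc xmat, ← mul_assoc A,
      ← (ymat_commute A).eq]
    simp only [mul_assoc]
  rw [e, e, ← Matrix.ext_iff]
  refine forall₂_congr fun i j => ?_
  simp only [Matrix.add_apply, Matrix.sub_apply, xmat_mul_apply, ymat_mul_apply,
    mul_sub, one_smul, mul_assoc]
  rw [← sub_eq_zero, ← sub_eq_zero (b := _ - _)]
  refine Eq.congr ?_ rfl
  abel

-- The RTT relation with the index pair of the first factor transposed: τ sends u to -u, so u - v
-- becomes u + v up to sign and the permutation becomes its partial transpose. In components it is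
-- the original relation at b̄, ā, c, d.
set_option maxHeartbeats 1000000 in
theorem IsRTT.mixed {θ : Fin (M + N) → ℂ} (hθ : IsTwist θ)
    {t : ℕ → Fin (M + N) → Fin (M + N) → C} (ht : IsRTT t) :
    legOne (genMat (tauFam θ t)) * rMat' θ * legTwo (genMat t) =
      legTwo (genMat t) * rMat' θ * legOne (genMat (tauFam θ t)) := by
  rw [mul_rMat'_mul_eq_iff]
  rintro ⟨a, c⟩ ⟨b, d⟩
  rw [linear_mul_eq_iff (one_ne_zero (α := ℂ))]
  refine ⟨fun q => zero_comm_aux (ht.tau hθ).zero q _ _, fun p => comm_zero_aux ht.zero p _ _,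
    fun p q => ?_⟩
  have h := ht.comm p q (bar b) (bar a) c d
  simp only [Matrix.sub_apply, legOne_mul_legTwo, legTwo_mul_legOne,
    legOne_mul_qMat_mul_legTwo, legTwo_mul_qMat_mul_legOne, map_sub, map_smul, cf_inU_mul_inV,
    cf_inV_mul_inU, coeff_genMat, tauFam, smul_mul_assoc, mul_smul_comm,
    smul_smul, hθ.bar_eq, parity_bar, bar_bar] at h ⊢
  simp only [smul_sub] at h ⊢
  rcases parity_eq a with pa | pa <;> rcases parity_eq b with pb | pb <;>
    rcases parity_eq c with pc | pc <;> rcases parity_eq d with pd | pd <;>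
    norm_num [pa, pb, pc, pd, pow_succ] at h ⊢ <;>
    rcases (hθ c).1 with tc | tc <;> rcases (hθ d).1 with td | td <;> simp only [tc, td] <;>
    first
    | linear_combination (norm := module) (θ a * θ b * (-1) ^ p) • h
    | linear_combination (norm := module) (-(θ a * θ b * (-1) ^ p)) • h

end Reflection

end TwistedSuperYangian

namespace TwistedSuperYangian

open PowerSeries

/-! ### Products of solutions and the reflection equation -/

section Products

variable {M N : ℕ} {C : Type*} [Ring C] [Algebra ℂ C]

/-- The family of coefficients of a product of two matrices of series. -/
def mulFam (t t' : ℕ → Fin (M + N) → Fin (M + N) → C) (p : ℕ) (a b : Fin (M + N)) : C :=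
  ∑ c, ∑ r ∈ Finset.HasAntidiagonal.antidiagonal p, t r.1 a c * t' r.2 c b

theorem genMat_mulFam (t t' : ℕ → Fin (M + N) → Fin (M + N) → C) :
    genMat (mulFam t t') = genMat t * genMat t' := by
  ext a b p
  simp [mulFam, Matrix.mul_apply, PowerSeries.coeff_mul]

theorem mulFam_zero {t t' : ℕ → Fin (M + N) → Fin (M + N) → C}
    (ht : ∀ a b, t 0 a b = if a = b then 1 else 0)
    (ht' : ∀ a b, t' 0 a b = if a = b then 1 else 0) (a b : Fin (M + N)) :
    mulFam t t' 0 a b = if a = b then 1 else 0 := by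
  simp [mulFam, ht, ht']

theorem legOne_commute_legTwo {t t' : ℕ → Fin (M + N) → Fin (M + N) → C}
    (h : ∀ p q a b c d, t' p a b * t q c d =
      (-1 : ℂ) ^ ((parity a + parity b) * (parity c + parity d)) • (t q c d * t' p a b)) :
    legOne (genMat t') * legTwo (genMat t) = legTwo (genMat t) * legOne (genMat t') := by
  ext1 i j
  rw [legOne_mul_legTwo, legTwo_mul_legOne]
  refine bi_ext fun p q => ?_
  simp only [map_smul, cf_inU_mul_inV, cf_inV_mul_inU, coeff_genMat, h, smul_smul]
  congr 1
  rcases parity_eq i.1 with ha | ha <;> rcases parity_eq j.1 with hb | hb <;>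
    rcases parity_eq i.2 with hc | hc <;> rcases parity_eq j.2 with hd | hd <;>
    norm_num [ha, hb, hc, hd]

/-- The coproduct argument: supercommuting factors let T₁T₁'T₂T₂' be regrouped so that R passes
through each pair in turn. -/
theorem IsRTT.mul {t t' : ℕ → Fin (M + N) → Fin (M + N) → C} (ht : IsRTT t) (ht' : IsRTT t')
    (h : ∀ p q a b c d, t' p a b * t q c d =
      (-1 : ℂ) ^ ((parity a + parity b) * (parity c + parity d)) • (t q c d * t' p a b)) :
    IsRTT (mulFam t t') := by
  refine (isRTT_iff _).2 ⟨mulFam_zero ht.zero ht'.zero, ?_⟩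
  have h1 := ((isRTT_iff _).1 ht).2
  have h2 := ((isRTT_iff _).1 ht').2
  have h3 := legOne_commute_legTwo h
  have h4 := legOne_commute_legTwo (t := t') (t' := t) fun p q a b c d => by
    rw [h q p c d a b, smul_smul, ← pow_add, mul_comm (parity c + _), ← two_mul]
    simp
  rw [genMat_mulFam, legOne_mul, legTwo_mul]
  generalize legOne (genMat t) = A at *
  generalize legOne (genMat t') = A' at *
  generalize legTwo (genMat t) = B at *
  generalize legTwo (genMat t') = B' at *
  calc rMat * (A * A' * (B * B')) = rMat * (A * (A' * B) * B') := by simp only [mul_assoc]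
    _ = (rMat * (A * B)) * (A' * B') := by rw [h3]; simp only [mul_assoc]
    _ = B * A * (rMat * (A' * B')) := by rw [h1]; simp only [mul_assoc]
    _ = B * (A * B') * A' * rMat := by rw [h2]; simp only [mul_assoc]
    _ = B * B' * (A * A') * rMat := by rw [h4]; simp only [mul_assoc]

theorem reflection {θ : Fin (M + N) → ℂ} (hθ : IsTwist θ)
    {t : ℕ → Fin (M + N) → Fin (M + N) → C} (ht : IsRTT t) :
    rMat * legOne (genMat (mulFam t (tauFam θ t))) * rMat' θ *
        legTwo (genMat (mulFam t (tauFam θ t))) =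
      legTwo (genMat (mulFam t (tauFam θ t))) * rMat' θ *
        legOne (genMat (mulFam t (tauFam θ t))) * rMat := by
  have h1 := ((isRTT_iff _).1 ht).2
  have h2 := ((isRTT_iff _).1 (ht.tau hθ)).2
  have h3 := ht.mixed hθ
  -- As τ is an involution, applying the mixed relation to τ(t) gives it with the roles of t and
  -- τ(t) exchanged.
  have h4 := (ht.tau hθ).mixed hθ
  rw [tauFam_tauFam hθ] at h4
  have h5 : (rMat : BiMat M N C) * rMat' θ = rMat' θ * rMat := rMat_commute_rMat' hθ
  rw [genMat_mulFam, legOne_mul, legTwo_mul]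
  generalize legOne (genMat t) = A at *
  generalize legOne (genMat (tauFam θ t)) = A' at *
  generalize legTwo (genMat t) = B at *
  generalize legTwo (genMat (tauFam θ t)) = B' at *
  generalize (rMat : BiMat M N C) = R at *
  generalize (rMat' θ : BiMat M N C) = R' at *
  calc R * (A * A') * R' * (B * B') = R * A * (A' * R' * B) * B' := by simp only [mul_assoc]
    _ = (R * (A * B)) * R' * A' * B' := by rw [h3]; simp only [mul_assoc]
    _ = B * A * (R * R') * A' * B' := by rw [h1]; simp only [mul_assoc]
    _ = B * A * R' * (R * (A' * B')) := by rw [h5]; simp only [mul_assoc]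
    _ = B * (A * R' * B') * A' * R := by rw [h2]; simp only [mul_assoc]
    _ = B * B' * R' * (A * A') * R := by rw [h4]; simp only [mul_assoc]

/-- Isolates the commutator. It is applied with a = y - x, b = x + y, e = xy: the left side carries
two powers of the variables and every term on the right at least three, which is the source of the
drop in weight. -/
theorem expand_reflection {R : Type*} [Ring R] {a b e P Q T U : R} (ha : ∀ F, Commute a F)
    (hb : ∀ F, Commute b F) (he : ∀ F, Commute e F)
    (h : (a - e * P) * T * (b + e * Q) * U = U * (b + e * Q) * T * (a - e * P)) :
    a * (b * (T * U - U * T)) = e * (b * (P * (T * U) - U * (T * P))) -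
      a * (e * (T * (Q * U) - U * (Q * T))) + e * (e * (P * (T * (Q * U)) - U * (Q * (T * P)))) := by
  have ca : ∀ F X : R, F * (a * X) = a * (F * X) := fun F X => (ha F).symm.left_comm X
  have cb : ∀ F X : R, F * (b * X) = b * (F * X) := fun F X => (hb F).symm.left_comm X
  have ce : ∀ F X : R, F * (e * X) = e * (F * X) := fun F X => (he F).symm.left_comm X
  simp only [sub_mul, mul_sub, add_mul, mul_add, mul_assoc, (ha T).eq.symm, (ha Q).eq.symm,
    (ha P).eq.symm, ca T, ca U, ca P, ca Q, cb T, cb U, cb P, cb Q, ce T, ce U, ce P, ce Q,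
    ca e, ca b, cb e] at h ⊢
  have h2 := sub_eq_zero.2 h
  rw [← sub_eq_zero, ← h2]
  abel

end Products

/-! ### Filtrations by weight of generators -/

section Filtration

variable {ι A : Type*} [Ring A] [Algebra ℂ A]

/-- The span of the products of generators of total weight at most `n`. -/
def filt (g : ι → A) (w : ι → ℕ) (n : ℤ) : Submodule ℂ A :=
  Submodule.span ℂ {x | ∃ l : List ι, ((l.map w).sum : ℤ) ≤ n ∧ (l.map g).prod = x}

/-- An increasing multiplicative filtration. -/
structure IsFilt (F : ℤ → Submodule ℂ A) : Prop where
  mono : ∀ {m n}, m ≤ n → F m ≤ F n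
  one_mem : ∀ {n}, 0 ≤ n → (1 : A) ∈ F n
  mul_mem : ∀ {m n x y}, x ∈ F m → y ∈ F n → x * y ∈ F (m + n)

theorem isFilt_filt (g : ι → A) (w : ι → ℕ) : IsFilt (filt g w) where
  mono h := Submodule.span_mono fun _ ⟨l, hl, hx⟩ => ⟨l, hl.trans h, hx⟩
  one_mem h := Submodule.subset_span ⟨[], by simpa using h, by simp⟩
  mul_mem {m n x y} hx hy := by
    have := Submodule.mul_mem_mul hx hy
    rw [filt, filt, Submodule.span_mul_span] at this
    refine Submodule.span_mono ?_ this
    rintro _ ⟨_, ⟨l, hl, rfl⟩, _, ⟨k, hk, rfl⟩, rfl⟩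
    exact ⟨l ++ k, by simpa using add_le_add hl hk, by simp⟩

theorem gen_mem_filt (g : ι → A) (w : ι → ℕ) (i : ι) : g i ∈ filt g w (w i) :=
  Submodule.subset_span ⟨[i], by simp, by simp⟩

/-- The base of the independence induction: below weight zero, "modulo lower terms" is an equality.
-/
theorem filt_neg (g : ι → A) (w : ι → ℕ) {n : ℤ} (hn : n < 0) : filt g w n = ⊥ := by
  rw [filt, Submodule.span_eq_bot]
  rintro _ ⟨l, hl, -⟩
  exfalso
  have : (0 : ℤ) ≤ ((l.map w).sum : ℤ) := Int.natCast_nonneg _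
  push_cast at *
  omega

variable {F : ℤ → Submodule ℂ A}

theorem IsFilt.algebraMap_mem (hF : IsFilt F) {n : ℤ} (hn : 0 ≤ n) (r : ℂ) :
    algebraMap ℂ A r ∈ F n := by
  rw [Algebra.algebraMap_eq_smul_one]
  exact Submodule.smul_mem _ _ (hF.one_mem hn)

/-- The bivariate series whose coefficient of `x ^ p * y ^ q` lies in degree `p + q + k`. -/
def biFilt (F : ℤ → Submodule ℂ A) (k : ℤ) : Submodule ℂ (Bi A) where
  carrier := {G | ∀ p q : ℕ, cf p q G ∈ F (p + q + k)}
  add_mem' ha hb p q := by rw [map_add]; exact add_mem (ha p q) (hb p q)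
  zero_mem' p q := by rw [map_zero]; exact zero_mem _
  smul_mem' c _ h p q := by rw [map_smul]; exact Submodule.smul_mem _ _ (h p q)

theorem cf_mul (p q : ℕ) (G H : Bi A) :
    cf p q (G * H) = ∑ r ∈ Finset.HasAntidiagonal.antidiagonal q,
      ∑ s ∈ Finset.HasAntidiagonal.antidiagonal p, cf s.1 r.1 G * cf s.2 r.2 H := by
  simp [cf, PowerSeries.coeff_mul]

theorem IsFilt.bi (hF : IsFilt F) {j k : ℤ} {G H : Bi A} (hG : G ∈ biFilt F j)
    (hH : H ∈ biFilt F k) : G * H ∈ biFilt F (j + k) := by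
  intro p q
  rw [cf_mul]
  refine sum_mem fun r hr => sum_mem fun s hs => ?_
  have h := hF.mul_mem (hG s.1 r.1) (hH s.2 r.2)
  rw [Finset.HasAntidiagonal.mem_antidiagonal] at hr hs
  convert h using 2
  rw [← hr, ← hs]
  push_cast
  ring

theorem xvar_mul_mem {k : ℤ} {G : Bi A} (hG : G ∈ biFilt F k) :
    xvar * G ∈ biFilt F (k - 1) := by
  rintro (_ | p) q
  · simp
  · rw [cf_succ_xvar_mul]
    convert hG p q using 2
    push_cast
    ring

theorem yvar_mul_mem {k : ℤ} {G : Bi A} (hG : G ∈ biFilt F k) :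
    yvar * G ∈ biFilt F (k - 1) := by
  rintro p (_ | q)
  · simp
  · rw [cf_succ_yvar_mul]
    convert hG p q using 2
    push_cast
    ring

theorem algebraMap_mem_biFilt (hF : IsFilt F) (r : ℂ) : algebraMap ℂ (Bi A) r ∈ biFilt F 0 := by
  rw [Algebra.algebraMap_eq_smul_one]
  refine Submodule.smul_mem _ _ fun p q => ?_
  simp only [cf, LinearMap.coe_mk, AddHom.coe_mk, PowerSeries.coeff_one]
  split_ifs
  · rw [PowerSeries.coeff_one]
    split_ifs
    · exact hF.one_mem (by positivity)
    · exact zero_mem _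
  · simp

end Filtration

/-! ### Supercommutators of the S-generators lose weight -/

section MatrixFiltration

variable {M N : ℕ} {C : Type*} [Ring C] [Algebra ℂ C] {F : ℤ → Submodule ℂ C}

/-- The matrices with all entries in `biFilt F k`. -/
def matFilt (F : ℤ → Submodule ℂ C) (k : ℤ) : Submodule ℂ (BiMat M N C) where
  carrier := {X | ∀ i j, X i j ∈ biFilt F k}
  add_mem' ha hb i j := add_mem (ha i j) (hb i j)
  zero_mem' _ _ := zero_mem _
  smul_mem' _ _ h i j := Submodule.smul_mem _ _ (h i j)

theorem IsFilt.mat (hF : IsFilt F) {j k : ℤ} {X Y : BiMat M N C} (hX : X ∈ matFilt F j)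
    (hY : Y ∈ matFilt F k) : X * Y ∈ matFilt F (j + k) := fun a b => by
  rw [Matrix.mul_apply]
  exact sum_mem fun c _ => hF.bi (hX a c) (hY c b)

theorem xmat_mul_mem {k : ℤ} {X : BiMat M N C} (hX : X ∈ matFilt F k) :
    xmat * X ∈ matFilt F (k - 1) := fun a b => by
  rw [xmat_mul_apply]
  exact xvar_mul_mem (hX a b)

theorem ymat_mul_mem {k : ℤ} {X : BiMat M N C} (hX : X ∈ matFilt F k) :
    ymat * X ∈ matFilt F (k - 1) := fun a b => by
  rw [ymat_mul_apply]
  exact yvar_mul_mem (hX a b)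

theorem permMat_mem (hF : IsFilt F) : (permMat : BiMat M N C) ∈ matFilt F 0 := fun i j => by
  simp only [permMat, Matrix.of_apply]
  split_ifs
  · exact algebraMap_mem_biFilt hF _
  · exact zero_mem _

theorem qMat_mem (hF : IsFilt F) (θ : Fin (M + N) → ℂ) :
    (qMat θ : BiMat M N C) ∈ matFilt F 0 := fun i j => by
  simp only [qMat, Matrix.of_apply]
  split_ifs
  · exact algebraMap_mem_biFilt hF _
  · exact zero_mem _

theorem legOne_mem {t : ℕ → Fin (M + N) → Fin (M + N) → C} (h : ∀ (p : ℕ) a b, t p a b ∈ F p) :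
    legOne (genMat t) ∈ matFilt F 0 := fun i j => by
  simp only [legOne, Matrix.of_apply]
  split_ifs
  · refine Submodule.smul_mem _ _ fun p q => ?_
    rw [← mul_one (inU _), ← map_one inV, cf_inU_mul_inV, coeff_genMat, PowerSeries.coeff_one]
    split_ifs with hq
    · subst hq
      simpa using h p i.1 j.1
    · simp
  · exact zero_mem _

theorem legTwo_mem {t : ℕ → Fin (M + N) → Fin (M + N) → C} (h : ∀ (p : ℕ) a b, t p a b ∈ F p) :
    legTwo (genMat t) ∈ matFilt F 0 := fun i j => by
  simp only [legTwo, Matrix.of_apply]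
  split_ifs
  · intro p q
    rw [← mul_one (inV _), ← map_one inU, cf_inV_mul_inU, coeff_genMat, PowerSeries.coeff_one]
    split_ifs with hq
    · subst hq
      simpa using h q i.2 j.2
    · simp
  · exact zero_mem _

theorem reflection_mem (hF : IsFilt F) {T U P Q : BiMat M N C} (hT : T ∈ matFilt F 0)
    (hU : U ∈ matFilt F 0) (hP : P ∈ matFilt F 0) (hQ : Q ∈ matFilt F 0) :
    xmat * ymat * ((xmat + ymat) * (P * (T * U) - U * (T * P))) -
        (ymat - xmat) * (xmat * ymat * (T * (Q * U) - U * (Q * T))) +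
        xmat * ymat * (xmat * ymat * (P * (T * (Q * U)) - U * (Q * (T * P)))) ∈
      matFilt F (-3) := by
  have hm : ∀ {X Y : BiMat M N C}, X ∈ matFilt F 0 → Y ∈ matFilt F 0 → X * Y ∈ matFilt F 0 :=
    fun hX hY => by simpa using hF.mat hX hY
  have ha : ∀ {k : ℤ} {X : BiMat M N C}, X ∈ matFilt F k →
      (ymat - xmat) * X ∈ matFilt F (k - 1) := fun hX => by
    rw [sub_mul]; exact sub_mem (ymat_mul_mem hX) (xmat_mul_mem hX)
  have hb : ∀ {k : ℤ} {X : BiMat M N C}, X ∈ matFilt F k →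
      (xmat + ymat) * X ∈ matFilt F (k - 1) := fun hX => by
    rw [add_mul]; exact add_mem (xmat_mul_mem hX) (ymat_mul_mem hX)
  have he : ∀ {k : ℤ} {X : BiMat M N C}, X ∈ matFilt F k →
      xmat * ymat * X ∈ matFilt F (k - 2) := fun {k X} hX => by
    rw [mul_assoc, show k - 2 = k - 1 - 1 by ring]; exact xmat_mul_mem (ymat_mul_mem hX)
  have hmono : ∀ {j k : ℤ} {X : BiMat M N C}, j ≤ k → X ∈ matFilt F j → X ∈ matFilt F k :=
    fun hjk hX i j p q => hF.mono (by linarith) (hX i j p q)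
  have h1 := he (hb (sub_mem (hm hP (hm hT hU)) (hm hU (hm hT hP))))
  have h2 := ha (he (sub_mem (hm hT (hm hQ hU)) (hm hU (hm hQ hT))))
  have h3 := he (he (sub_mem (hm hP (hm hT (hm hQ hU))) (hm hU (hm hQ (hm hT hP)))))
  norm_num at h1 h2 h3
  exact add_mem (sub_mem h1 h2) (hmono (by norm_num) h3)

/-- Division by (y-x)(x+y) = y² - x²: the coefficient at (p, q) differs from the one at (p-2, q+2),
of the same total degree, by an element of the required filtration step, and the recursion ends at p
= 0 or 1. -/
theorem commutator_coeff_mem {D : BiMat M N C}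
    (hD : (ymat - xmat) * ((xmat + ymat) * D) ∈ matFilt F (-3)) (p q : ℕ)
    (i j : Fin (M + N) × Fin (M + N)) : cf p q (D i j) ∈ F (p + q - 1) := by
  have e : (ymat - xmat) * ((xmat + ymat) * D) = ymat * (ymat * D) - xmat * (xmat * D) := by
    have := (xmat_commute (ymat : BiMat M N C)).eq
    simp only [sub_mul, add_mul, mul_add, ← mul_assoc, this]
    abel
  rw [e] at hD
  induction p using Nat.strong_induction_on generalizing q with
  | _ p ih =>
    have hmij := hD i j p (q + 2)
    rw [Matrix.sub_apply] at hmij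
    simp only [xmat_mul_apply, ymat_mul_apply, map_sub, cf_succ_yvar_mul] at hmij
    have h1 : ((p : ℤ) + ((q + 2 : ℕ) : ℤ) + (-3)) = p + q - 1 := by push_cast; ring
    rw [h1] at hmij
    rcases p with _ | _ | p
    · simpa using hmij
    · simpa using hmij
    · have h2 := ih p (by omega) (q + 2)
      have h3 : ((p : ℤ) + ((q + 2 : ℕ) : ℤ) - 1) = ((p + 1 + 1 : ℕ) : ℤ) + q - 1 := by
        push_cast; ring
      rw [h3] at h2
      simp only [cf_succ_xvar_mul] at hmij
      have := add_mem hmij h2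
      rwa [sub_add_cancel] at this

theorem commutator_mem_filt {θ : Fin (M + N) → ℂ} (hθ : IsTwist θ)
    {t : ℕ → Fin (M + N) → Fin (M + N) → C} (ht : IsRTT t) (hF : IsFilt F)
    (h : ∀ (p : ℕ) a b, mulFam t (tauFam θ t) p a b ∈ F p) (p q : ℕ) (a b c d : Fin (M + N)) :
    mulFam t (tauFam θ t) p a b * mulFam t (tauFam θ t) q c d -
      (-1 : ℂ) ^ ((parity a + parity b) * (parity c + parity d)) •
        (mulFam t (tauFam θ t) q c d * mulFam t (tauFam θ t) p a b) ∈ F (p + q - 1) := by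
  have hr := reflection hθ ht
  generalize mulFam t (tauFam θ t) = s at *
  have hm := reflection_mem hF (legOne_mem h) (legTwo_mem h)
    (permMat_mem hF : (permMat : BiMat M N C) ∈ matFilt F 0) (qMat_mem hF θ)
  unfold rMat rMat' at hr
  rw [← mul_assoc xmat, ← mul_assoc xmat] at hr
  rw [← expand_reflection (fun F => (ymat_commute F).sub_left (xmat_commute F))
    (fun F => (xmat_commute F).add_left (ymat_commute F))
    (fun F => (xmat_commute F).mul_left (ymat_commute F)) hr] at hm
  have hk := commutator_coeff_mem hm p q (a, c) (b, d)
  rw [Matrix.sub_apply, legOne_mul_legTwo, legTwo_mul_legOne] at hk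
  simp only [map_sub, map_smul, cf_inU_mul_inV, cf_inV_mul_inU, coeff_genMat] at hk
  -- Removes the sign of the first leg, turning the commutator of matrices into the supercommutator
  -- of entries.
  have := Submodule.smul_mem _ ((-1 : ℂ) ^ ((parity a + parity b) * parity c)) hk
  rw [smul_sub, smul_smul, smul_smul, ← pow_add, ← pow_add, ← mul_add, ← mul_add,
    ← two_mul, Even.neg_one_pow ((even_two_mul _).mul_left _), one_smul] at this
  exact this

end MatrixFiltration

end TwistedSuperYangian

namespace TwistedSuperYangian

open PowerSeries

/-! ### The symmetry relation, by setting u = v -/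

section Symmetry

variable {M N : ℕ} {C : Type*} [Ring C] [Algebra ℂ C]

/-- The sum of the coefficients of total degree `n`: substitution of `x` for `y`. -/
def diagCoeff (n : ℕ) : Bi C →ₗ[ℂ] C :=
  ∑ r ∈ Finset.HasAntidiagonal.antidiagonal n, cf r.1 r.2

theorem diagCoeff_xvar_mul (n : ℕ) (F : Bi C) :
    diagCoeff (n + 1) (xvar * F) = diagCoeff n F := by
  simp only [diagCoeff, LinearMap.sum_apply]
  rw [Finset.Nat.sum_antidiagonal_succ]
  simp

theorem diagCoeff_yvar_mul (n : ℕ) (F : Bi C) :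
    diagCoeff (n + 1) (yvar * F) = diagCoeff n F := by
  simp only [diagCoeff, LinearMap.sum_apply]
  rw [Finset.Nat.sum_antidiagonal_succ']
  simp

theorem diagCoeff_inU_mul_inV (n : ℕ) (f g : PowerSeries C) :
    diagCoeff n (inU f * inV g) = coeff n (f * g) := by
  simp [diagCoeff, LinearMap.sum_apply, cf_inU_mul_inV, PowerSeries.coeff_mul]

theorem diagCoeff_inV_mul_inU (n : ℕ) (f g : PowerSeries C) :
    diagCoeff n (inV g * inU f) = coeff n (g * f) := by
  simp only [diagCoeff, LinearMap.sum_apply, cf_inV_mul_inU, PowerSeries.coeff_mul]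
  rw [← Finset.Nat.sum_antidiagonal_swap]
  simp

/-- The scalar relating `S^{ab}` to `S^{b̄ā}`. -/
def twistSign (θ : Fin (M + N) → ℂ) (p : ℕ) (a b : Fin (M + N)) : ℂ :=
  (-1 : ℂ) ^ (parity a * (parity b + 1)) * θ a * θ b * (-1) ^ p

theorem coeff_mul_genMat (t t' : ℕ → Fin (M + N) → Fin (M + N) → C) (p : ℕ)
    (a b c d : Fin (M + N)) : coeff p (genMat t a b * genMat t' c d) =
      ∑ r ∈ Finset.HasAntidiagonal.antidiagonal p, t r.1 a b * t' r.2 c d := by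
  simp [PowerSeries.coeff_mul]

/-- Applying τ to the entries of T τ(T) produces the same sum over c with the two factors in the
opposite order, so comparing S^{b̄ā} with S^{ab} amounts to commuting T past τ(T). -/
theorem twistSign_smul_mulFam {θ : Fin (M + N) → ℂ} (hθ : IsTwist θ)
    (t : ℕ → Fin (M + N) → Fin (M + N) → C) (p : ℕ) (a b : Fin (M + N)) :
    twistSign θ p a b • mulFam t (tauFam θ t) p (bar b) (bar a) =
      ∑ c, (-1 : ℂ) ^ ((parity a + parity c) * (parity c + parity b)) •
        coeff p (genMat (tauFam θ t) c b * genMat t a c) := by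
  simp only [coeff_mul_genMat, mulFam, Finset.smul_sum]
  rw [← Equiv.sum_comp barEquiv]
  refine Finset.sum_congr rfl fun c _ => Finset.sum_congr rfl fun r hr => ?_
  rw [Finset.HasAntidiagonal.mem_antidiagonal] at hr
  simp only [barEquiv, Equiv.coe_fn_mk, tauFam, bar_bar, parity_bar, hθ.bar_eq, smul_mul_assoc,
    mul_smul_comm, smul_smul, twistSign, ← hr]
  congr 1
  have h2 : (-1 : ℂ) ^ r.2 * (-1) ^ r.2 = 1 := by rw [← mul_pow]; simp
  have ha := hθ.mul_self a
  rcases parity_eq a with pa | pa <;> rcases parity_eq b with pb | pb <;>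
    rcases parity_eq c with pc | pc <;> norm_num [pa, pb, pc, pow_add] <;>
    linear_combination (θ b * θ c * (-1) ^ r.1) * (θ a * θ a * h2 + ha)

theorem symmetry {θ : Fin (M + N) → ℂ} (hθ : IsTwist θ)
    {t : ℕ → Fin (M + N) → Fin (M + N) → C} (ht : IsRTT t) (p : ℕ) (a b : Fin (M + N)) :
    (2 : ℂ) • (twistSign θ (p + 1) a b • mulFam t (tauFam θ t) (p + 1) (bar b) (bar a) -
        mulFam t (tauFam θ t) (p + 1) a b) =
      (1 - (-1 : ℂ) ^ p) • mulFam t (tauFam θ t) p a b := by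
  have h := (mul_rMat'_mul_eq_iff θ _ _).1 (ht.mixed hθ)
  have hc : ∀ c, (2 : ℂ) • diagCoeff (p + 1) ((legOne (genMat (tauFam θ t)) * legTwo (genMat t) -
      legTwo (genMat t) * legOne (genMat (tauFam θ t))) (c, a) (b, c)) =
      diagCoeff p ((legTwo (genMat t) * qMat θ * legOne (genMat (tauFam θ t)) -
        legOne (genMat (tauFam θ t)) * (qMat θ * legTwo (genMat t)) : BiMat M N C) (c, a) (b, c)) := by
    intro c
    -- At x = y the factor x + y becomes 2x, whence the factor 2 and the drop by one in degree.
    have := congrArg (diagCoeff (p + 2)) (h (c, a) (b, c))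
    rw [map_add, map_smul, diagCoeff_xvar_mul, diagCoeff_yvar_mul, diagCoeff_xvar_mul,
      diagCoeff_yvar_mul] at this
    rw [← this, one_smul, two_smul]
  have e1 : mulFam t (tauFam θ t) (p + 1) a b =
      ∑ c, coeff (p + 1) (genMat t a c * genMat (tauFam θ t) c b) := by
    simp [mulFam, coeff_mul_genMat]
  have e2 : mulFam t (tauFam θ t) p a b =
      ∑ c, coeff p (genMat t a (bar c) * genMat (tauFam θ t) (bar c) b) := by
    simp only [mulFam, coeff_mul_genMat]
    exact (Equiv.sum_comp barEquiv _).symm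
  have e3 : (-1 : ℂ) ^ p • mulFam t (tauFam θ t) p a b =
      ∑ c, (θ (bar a) * θ b * (-1) ^ (parity a * parity b) *
        (-1 : ℂ) ^ ((parity b + parity c) * (parity c + parity a))) •
        coeff p (genMat (tauFam θ t) c (bar a) * genMat t (bar b) c) := by
    have := congrArg (fun z => (θ (bar a) * θ b * (-1) ^ (parity a * parity b)) • z)
      (twistSign_smul_mulFam hθ t p (bar b) (bar a))
    simp only [bar_bar, Finset.smul_sum, smul_smul, parity_bar] at this
    rw [← this]
    congr 1
    simp only [twistSign, parity_bar, hθ.bar_eq]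
    rcases parity_eq a with pa | pa <;> rcases parity_eq b with pb | pb <;>
      rcases (hθ a).1 with ha | ha <;> rcases (hθ b).1 with hb | hb <;>
      simp [pa, pb, ha, hb]
  rw [sub_smul, one_smul, e3, e2, twistSign_smul_mulFam hθ, e1, ← Finset.sum_sub_distrib,
    ← Finset.sum_sub_distrib, Finset.smul_sum]
  refine Finset.sum_congr rfl fun c _ => ?_
  have h3 := congrArg (fun z => (-1 : ℂ) ^ ((parity c + parity b) * parity c) • z) (hc c)
  simp only [Matrix.sub_apply, legOne_mul_legTwo, legTwo_mul_legOne,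
    legOne_mul_qMat_mul_legTwo, legTwo_mul_qMat_mul_legOne, map_sub, map_smul,
    diagCoeff_inU_mul_inV, diagCoeff_inV_mul_inU, smul_sub, smul_smul, bar_bar] at h3 ⊢
  simp only [hθ.bar_eq] at h3 ⊢
  rcases parity_eq a with pa | pa <;> rcases parity_eq b with pb | pb <;>
    rcases parity_eq c with pc | pc <;> rcases (hθ c).1 with tc | tc <;>
    norm_num [pa, pb, pc, tc] at h3 ⊢ <;>
    linear_combination (norm := module) h3

end Symmetry

end TwistedSuperYangian

namespace TwistedSuperYangian

open PowerSeries

/-! ### The relations inside the superYangian -/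

section Yangian

variable {M N : ℕ}

theorem isRTT_T : IsRTT (T : ℕ → Fin (M + N) → Fin (M + N) → SuperYangian M N) where
  zero a b := by
    have := RingQuot.mkAlgHom_rel ℂ (Rel.zero (M := M) (N := N) a b)
    refine this.trans ?_
    split_ifs
    · exact map_one _
    · exact map_zero _
  comm p q a b c d := by
    have := RingQuot.mkAlgHom_rel ℂ (Rel.comm (M := M) (N := N) p q a b c d)
    simp only [map_sub, map_smul, map_mul] at this
    exact this

theorem S_eq_mulFam (θ : Fin (M + N) → ℂ) : S θ = mulFam T (tauFam θ T) := by
  funext p a b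
  refine Finset.sum_congr rfl fun c _ => ?_
  rw [← Finset.Nat.sum_antidiagonal_swap, Finset.Nat.sum_antidiagonal_eq_sum_range_succ_mk]
  rfl

theorem S_zero {θ : Fin (M + N) → ℂ} (hθ : IsTwist θ) (a b : Fin (M + N)) :
    S θ 0 a b = if a = b then 1 else 0 := by
  rw [S_eq_mulFam]
  exact mulFam_zero isRTT_T.zero (isRTT_T.tau hθ).zero a b

/-- The filtration of the twisted superYangian in which `S_{(p)}` has degree `p`. -/
def filtS (θ : Fin (M + N) → ℂ) : ℤ → Submodule ℂ (SuperYangian M N) :=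
  filt (fun x : ℕ × Fin (M + N) × Fin (M + N) => S θ (x.1 + 1) x.2.1 x.2.2) (fun x => x.1 + 1)

theorem isFilt_filtS (θ : Fin (M + N) → ℂ) : IsFilt (filtS θ) := isFilt_filt _ _

theorem S_mem_filtS {θ : Fin (M + N) → ℂ} (hθ : IsTwist θ) (p : ℕ) (a b : Fin (M + N)) :
    S θ p a b ∈ filtS θ p := by
  rcases p with _ | p
  · rw [S_zero hθ]
    split_ifs
    · exact (isFilt_filtS θ).one_mem (by simp)
    · exact zero_mem _
  · exact gen_mem_filt (fun x : ℕ × Fin (M + N) × Fin (M + N) => S θ (x.1 + 1) x.2.1 x.2.2)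
      (fun x => x.1 + 1) (p, a, b)

theorem S_commutator_mem {θ : Fin (M + N) → ℂ} (hθ : IsTwist θ) (p q : ℕ)
    (a b c d : Fin (M + N)) :
    S θ p a b * S θ q c d -
      (-1 : ℂ) ^ ((parity a + parity b) * (parity c + parity d)) •
        (S θ q c d * S θ p a b) ∈ filtS θ (p + q - 1) := by
  have h := fun (p : ℕ) a b => S_mem_filtS hθ p a b
  rw [S_eq_mulFam] at *
  exact commutator_mem_filt hθ isRTT_T (isFilt_filtS θ) h p q a b c d

theorem S_symmetry_mem {θ : Fin (M + N) → ℂ} (hθ : IsTwist θ) (p : ℕ) (a b : Fin (M + N)) :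
    twistSign θ (p + 1) a b • S θ (p + 1) (bar b) (bar a) - S θ (p + 1) a b ∈ filtS θ p := by
  have h := symmetry hθ isRTT_T p a b
  rw [← S_eq_mulFam] at h
  have h2 := Submodule.smul_mem _ ((2 : ℂ)⁻¹)
    (Submodule.smul_mem _ (1 - (-1 : ℂ) ^ p) (S_mem_filtS hθ p a b))
  rw [← h, smul_smul, inv_mul_cancel₀ two_ne_zero, one_smul] at h2
  exact h2

theorem exists_mem_filtS {θ : Fin (M + N) → ℂ} (hθ : IsTwist θ) {x : SuperYangian M N}
    (hx : x ∈ twisted θ) : ∃ n : ℕ, x ∈ filtS θ n := by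
  have hF := isFilt_filtS θ
  induction hx using Algebra.adjoin_induction with
  | mem x hx =>
    obtain ⟨p, a, b, rfl⟩ := hx
    exact ⟨p, S_mem_filtS hθ p a b⟩
  | algebraMap r => exact ⟨0, hF.algebraMap_mem (by simp) r⟩
  | add x y _ _ hx hy =>
    obtain ⟨m, hm⟩ := hx
    obtain ⟨n, hn⟩ := hy
    exact ⟨m + n, add_mem (hF.mono (by push_cast; omega) hm) (hF.mono (by push_cast; omega) hn)⟩
  | mul x y _ _ hx hy =>
    obtain ⟨m, hm⟩ := hx
    obtain ⟨n, hn⟩ := hy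
    exact ⟨m + n, by exact_mod_cast hF.mul_mem hm hn⟩

end Yangian

/-! ### Straightening: ordered monomials span -/

section Monomials

variable {M n : ℕ}

/-- The PBW generator with a given label. -/
def SL (θ : Fin (M + 2 * n) → ℂ) (x : PBWLabel M n) : SuperYangian M (2 * n) := S θ x.p x.i x.j

variable [LinearOrder (PBWLabel M n)]

/-- The ordered monomial with an arbitrary exponent. -/
def mon (θ : Fin (M + 2 * n) → ℂ) (f : PBWLabel M n →₀ ℕ) : SuperYangian M (2 * n) :=
  ((f.support.sort (· ≤ ·)).map fun x => SL θ x ^ f x).prod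

@[simp] theorem mon_zero (θ : Fin (M + 2 * n) → ℂ) : mon θ 0 = 1 := by simp [mon]

theorem mon_add_single (θ : Fin (M + 2 * n) → ℂ) {f : PBWLabel M n →₀ ℕ} {x : PBWLabel M n}
    (h : ∀ y ∈ f.support, x ≤ y) : mon θ (f + Finsupp.single x 1) = SL θ x * mon θ f := by
  have hs : (f + Finsupp.single x 1).support = insert x f.support := by
    ext y
    by_cases hy : y = x <;> simp [hy, Finsupp.single_apply, Ne.symm]
  have hins : insert x f.support = insert x (f.support.erase x) := by
    ext y; by_cases hy : y = x <;> simp [hy]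
  have hsort : (insert x (f.support.erase x)).sort (· ≤ ·) =
      x :: (f.support.erase x).sort (· ≤ ·) :=
    Finset.sort_insert _ (fun b hb => h b (Finset.mem_of_mem_erase hb))
      (Finset.notMem_erase x _)
  have hmap : ((f.support.erase x).sort (· ≤ ·)).map
      (fun y => SL θ y ^ (f + Finsupp.single x 1 : PBWLabel M n →₀ ℕ) y) =
      ((f.support.erase x).sort (· ≤ ·)).map (fun y => SL θ y ^ f y) := by
    refine List.map_congr_left fun y hy => ?_
    have : y ≠ x := Finset.ne_of_mem_erase ((Finset.mem_sort _).1 hy)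
    simp [this, Finsupp.single_apply, Ne.symm this]
  have hf : mon θ f = SL θ x ^ f x *
      (((f.support.erase x).sort (· ≤ ·)).map (fun y => SL θ y ^ f y)).prod := by
    by_cases hx : x ∈ f.support
    · have : f.support = insert x (f.support.erase x) := (Finset.insert_erase hx).symm
      rw [mon, this, hsort, List.map_cons, List.prod_cons, ← this]
    · rw [Finset.erase_eq_of_notMem hx, Finsupp.notMem_support_iff.1 hx, pow_zero, one_mul, mon]
  rw [hf, mon, hs, hins, hsort, List.map_cons, List.prod_cons, hmap, ← mul_assoc, ← pow_succ']
  simp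

/-- Any ordered monomial is built by multiplying on the left by generators no larger than those
already present: strip off the smallest label and induct on the degree. -/
theorem mon_induction {P : (PBWLabel M n →₀ ℕ) → Prop} (h0 : P 0)
    (h1 : ∀ f x, (∀ y ∈ f.support, x ≤ y) → P f → P (f + Finsupp.single x 1))
    (f : PBWLabel M n →₀ ℕ) : P f := by
  induction hk : f.degree generalizing f with
  | zero => rwa [(Finsupp.degree_eq_zero_iff f).1 hk]
  | succ k ih =>
    have hne : f.support.Nonempty := by
      rw [Finsupp.support_nonempty_iff]
      rintro rfl
      simp at hk
    set x := f.support.min' hne with hx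
    have hxs : x ∈ f.support := Finset.min'_mem _ _
    have hle : Finsupp.single x 1 ≤ f := by
      rw [Finsupp.single_le_iff]
      exact Nat.one_le_iff_ne_zero.2 (Finsupp.mem_support_iff.1 hxs)
    have he : f - Finsupp.single x 1 + Finsupp.single x 1 = f := tsub_add_cancel_of_le hle
    rw [← he]
    refine h1 _ _ (fun y hy => Finset.min'_le _ _ ?_) (ih _ ?_)
    · rw [Finsupp.mem_support_iff] at hy ⊢
      intro h
      exact hy (by simp [h])
    · have := congrArg Finsupp.degree he
      rw [map_add, Finsupp.degree_single] at this
      omega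

/-- The total weight of an exponent. -/
def weightOf (w : PBWLabel M n → ℕ) : (PBWLabel M n →₀ ℕ) →+ ℕ :=
  Finsupp.liftAddHom fun x => (AddMonoidHom.mulRight (w x))

@[simp] theorem weightOf_single (w : PBWLabel M n → ℕ) (x : PBWLabel M n) :
    weightOf w (Finsupp.single x 1) = w x := by
  simp [weightOf]

theorem mon_mem {F : ℤ → Submodule ℂ (SuperYangian M (2 * n))} (hF : IsFilt F)
    {θ : Fin (M + 2 * n) → ℂ} {w : PBWLabel M n → ℕ} (h : ∀ x, SL θ x ∈ F (w x))
    (f : PBWLabel M n →₀ ℕ) : mon θ f ∈ F (weightOf w f) := by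
  induction f using mon_induction with
  | h0 => simpa using hF.one_mem le_rfl
  | h1 f x hx ih =>
    rw [mon_add_single θ hx, map_add, weightOf_single, add_comm]
    exact_mod_cast hF.mul_mem (h x) ih

/-- The weight of an exponent when `S_{(p)}` has weight `p`. -/
def pWeight : (PBWLabel M n →₀ ℕ) →+ ℕ := weightOf PBWLabel.p

theorem SL_mem {θ : Fin (M + 2 * n) → ℂ} (hθ : IsTwist θ) (x : PBWLabel M n) :
    SL θ x ∈ filtS θ x.p := S_mem_filtS hθ _ _ _

/-- Insertion into an ordered monomial: the new generator moves right past smaller ones, each move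
costing a sign and a supercommutator of lower weight. Only nonvanishing of the accumulated sign ε is
needed later. -/
theorem SL_mul_mon {θ : Fin (M + 2 * n) → ℂ} (hθ : IsTwist θ) (x : PBWLabel M n)
    (f : PBWLabel M n →₀ ℕ) : ∃ ε : ℂ, ε ≠ 0 ∧
      SL θ x * mon θ f - ε • mon θ (f + Finsupp.single x 1) ∈
        filtS θ (x.p + pWeight f - 1) := by
  have hF := isFilt_filtS θ
  induction f using mon_induction with
  | h0 => exact ⟨1, one_ne_zero, by rw [mon_add_single θ (by simp)]; simp⟩
  | h1 f y hy ih =>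
    by_cases hxy : x ≤ y
    · refine ⟨1, one_ne_zero, ?_⟩
      rw [mon_add_single θ (f := f + _)]
      · simp
      · intro z hz
        rcases Finset.mem_union.1 (Finsupp.support_add hz) with h | h
        · exact hxy.trans (hy z h)
        · rwa [Finset.mem_singleton.1 (Finsupp.support_single_subset h)]
    · obtain ⟨ε, hε, h⟩ := ih
      have hc := S_commutator_mem hθ x.p y.p x.i x.j y.i y.j
      refine ⟨(-1 : ℂ) ^ ((parity x.i + parity x.j) * (parity y.i + parity y.j)) * ε,
        mul_ne_zero (by simp) hε, ?_⟩
      set δ := (-1 : ℂ) ^ ((parity x.i + parity x.j) * (parity y.i + parity y.j))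
      have e : mon θ (f + Finsupp.single y 1 + Finsupp.single x 1) =
          SL θ y * mon θ (f + Finsupp.single x 1) := by
        rw [add_right_comm, mon_add_single θ]
        intro z hz
        rcases Finset.mem_union.1 (Finsupp.support_add hz) with h | h
        · exact hy z h
        · rw [Finset.mem_singleton.1 (Finsupp.support_single_subset h)]
          exact (not_le.1 hxy).le
      rw [e, mon_add_single θ hy]
      have h1 := hF.mul_mem hc (mon_mem hF (SL_mem hθ) f)
      have h2 := Submodule.smul_mem _ δ (hF.mul_mem (SL_mem hθ y) h)
      have e2 : SL θ x * (SL θ y * mon θ f) -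
          (δ * ε) • (SL θ y * mon θ (f + Finsupp.single x 1)) =
          (SL θ x * SL θ y - δ • (SL θ y * SL θ x)) * mon θ f +
          δ • (SL θ y * (SL θ x * mon θ f - ε • mon θ (f + Finsupp.single x 1))) := by
        simp only [sub_mul, mul_sub, smul_sub, smul_mul_assoc, mul_smul_comm, smul_smul, mul_assoc]
        abel
      rw [e2]
      simp only [pWeight, map_add, weightOf_single] at *
      refine add_mem (hF.mono ?_ h1) (hF.mono ?_ h2) <;> push_cast <;> linarith

/-- For an odd generator the supercommutator with itself is twice its square, so a repeated odd
factor has lower weight; this is why odd exponents stop at 1. -/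
theorem mon_mem_of_two_le {θ : Fin (M + 2 * n) → ℂ} (hθ : IsTwist θ) {x : PBWLabel M n}
    (hx : parity x.i ≠ parity x.j) {f : PBWLabel M n →₀ ℕ} (hf : 2 ≤ f x) :
    mon θ f ∈ filtS θ (pWeight f - 1) := by
  have hF := isFilt_filtS θ
  obtain ⟨g, rfl⟩ : ∃ g, f = g + Finsupp.single x 1 + Finsupp.single x 1 := by
    refine ⟨f - Finsupp.single x 2, ?_⟩
    rw [add_assoc, ← Finsupp.single_add, tsub_add_cancel_of_le]
    rwa [Finsupp.single_le_iff]
  obtain ⟨ε, hε, h⟩ := SL_mul_mon hθ x g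
  obtain ⟨ε', hε', h'⟩ := SL_mul_mon hθ x (g + Finsupp.single x 1)
  have hc := S_commutator_mem hθ x.p x.p x.i x.j x.i x.j
  have hsq : SL θ x * SL θ x ∈ filtS θ (x.p + x.p - 1) := by
    have hp : parity x.i + parity x.j = 1 := by
      rcases parity_eq x.i with h1 | h1 <;> rcases parity_eq x.j with h2 | h2 <;>
        simp [h1, h2] at hx ⊢
    rw [hp] at hc
    have := Submodule.smul_mem _ ((2 : ℂ)⁻¹) hc
    convert this using 1
    simp only [SL]
    module
  have h1 := hF.mul_mem hsq (mon_mem hF (SL_mem hθ) g)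
  have h2 := hF.mul_mem (SL_mem hθ x) h
  have e : mon θ (g + Finsupp.single x 1 + Finsupp.single x 1) = (ε' * ε)⁻¹ •
      (SL θ x * SL θ x * mon θ g -
        SL θ x * (SL θ x * mon θ g - ε • mon θ (g + Finsupp.single x 1)) -
        ε • (SL θ x * mon θ (g + Finsupp.single x 1) -
          ε' • mon θ (g + Finsupp.single x 1 + Finsupp.single x 1))) := by
    rw [eq_inv_smul_iff₀ (mul_ne_zero hε' hε)]
    simp only [mul_sub, smul_sub, mul_smul_comm, smul_smul, mul_assoc, mul_comm ε']
    abel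
  rw [e]
  simp only [pWeight, map_add, weightOf_single] at *
  refine Submodule.smul_mem _ _ (sub_mem (sub_mem (hF.mono ?_ h1) (hF.mono ?_ h2))
    (Submodule.smul_mem _ _ (hF.mono ?_ h'))) <;> push_cast <;> linarith

/-- The index set meets every orbit of (a,b) ↦ (b̄,ā), except the fixed points on which the symmetry
sign is -1. -/
theorem isPBWIndex_or (p : ℕ) (a b : Fin (M + 2 * n)) :
    IsPBWIndex M n p (a.val + 1) (b.val + 1) ∨
      IsPBWIndex M n p ((bar b).val + 1) ((bar a).val + 1) ∨
        bar b = a ∧ Odd (parity a + p) := by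
  have ha := a.isLt
  have hb := b.isLt
  have e : ∀ c : Fin (M + 2 * n), (bar c).val =
      if c.val < M then M - 1 - c.val else 2 * M + 2 * n - 1 - c.val := by
    intro c; unfold bar; split_ifs <;> rfl
  simp only [Fin.ext_iff, e, IsPBWIndex, parity, Nat.even_iff, Nat.odd_iff]
  split_ifs <;> omega

theorem S_mem_span_sup {θ : Fin (M + 2 * n) → ℂ} (hθ : IsTwist θ) (p : ℕ)
    (a b : Fin (M + 2 * n)) :
    ∃ (c : ℂ) (y : SuperYangian M (2 * n)),
      (c = 0 ∨ ∃ x : PBWLabel M n, x.p = p + 1 ∧ y = SL θ x) ∧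
        S θ (p + 1) a b - c • y ∈ filtS θ p := by
  have h := S_symmetry_mem hθ p a b
  rcases isPBWIndex_or (p + 1) a b with h1 | h1 | ⟨h1, h2⟩
  · exact ⟨1, _, Or.inr ⟨⟨p + 1, a, b, by simp, h1⟩, rfl, rfl⟩, by simp [SL]⟩
  · refine ⟨twistSign θ (p + 1) a b, _, Or.inr ⟨⟨p + 1, _, _, by simp, h1⟩, rfl, rfl⟩, ?_⟩
    rw [← neg_sub]
    exact neg_mem h
  · refine ⟨0, 0, Or.inl rfl, ?_⟩
    have h3 : bar a = b := by rw [← h1, bar_bar]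
    -- Here the symmetry relation reads -2S ≡ 0, so the generator itself is of lower weight.
    have e : twistSign θ (p + 1) a b = -1 := by
      rw [← Odd.neg_one_pow h2, ← h3, twistSign, hθ.bar_eq, parity_bar, pow_add]
      rcases parity_eq a with pa | pa <;> rcases (hθ a).1 with ha | ha <;>
        simp [pa, ha, pow_succ, pow_add]
    rw [h1, h3, e] at h
    have := Submodule.smul_mem _ (-(2 : ℂ)⁻¹) h
    convert this using 1
    module

/-- The exponents that occur in the PBW basis. -/
def IsPBWExp (f : PBWLabel M n →₀ ℕ) : Prop := ∀ x, parity x.i ≠ parity x.j → f x ≤ 1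

/-- Strong induction on weight: order the tail of a product, replace the head by a PBW generator,
insert it. Every error term has weight below k and is covered by induction. -/
theorem filtS_le_span {θ : Fin (M + 2 * n) → ℂ} (hθ : IsTwist θ) (k : ℕ) :
    filtS θ k ≤ Submodule.span ℂ {x | ∃ f, IsPBWExp f ∧ pWeight f ≤ k ∧ mon θ f = x} := by
  have hF := isFilt_filtS θ
  induction k using Nat.strong_induction_on with
  | _ k ih =>
    have hmono : ∀ {i j : ℕ}, i ≤ j →
        Submodule.span ℂ {x | ∃ f, IsPBWExp f ∧ pWeight f ≤ i ∧ mon θ f = x} ≤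
        Submodule.span ℂ {x | ∃ f, IsPBWExp f ∧ pWeight f ≤ j ∧ mon θ f = x} :=
      fun hij => Submodule.span_mono fun x ⟨f, hf, hw, hx⟩ => ⟨f, hf, hw.trans hij, hx⟩
    refine Submodule.span_le.2 ?_
    rintro _ ⟨l, hl, rfl⟩
    rcases l with _ | ⟨⟨p, a, b⟩, l⟩
    · exact Submodule.subset_span ⟨0, fun _ _ => by simp, by simp, by simp⟩
    · simp only [List.map_cons, List.sum_cons, List.prod_cons] at hl ⊢
      have hl' : p + 1 + (l.map fun x => x.1 + 1).sum ≤ k := by exact_mod_cast hl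
      obtain ⟨j, rfl⟩ : ∃ j, k = p + 1 + j := ⟨k - (p + 1), by omega⟩
      have hrest := ih j (by omega) (Submodule.subset_span ⟨l, by
        simp only [Nat.add_le_add_iff_left] at hl'; exact_mod_cast hl', rfl⟩)
      have hlow := (ih (p + j) (by omega)).trans (hmono (show p + j ≤ p + 1 + j by omega))
      refine Submodule.span_induction (p := fun z _ => S θ (p + 1) a b * z ∈
        Submodule.span ℂ {x | ∃ f, IsPBWExp f ∧ pWeight f ≤ p + 1 + j ∧ mon θ f = x})
        ?_ (by simp) (fun x y _ _ hx hy => by rw [mul_add]; exact add_mem hx hy)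
        (fun c x _ hx => by rw [mul_smul_comm]; exact Submodule.smul_mem _ _ hx) hrest
      rintro _ ⟨g, hg, hgw, rfl⟩
      have hmg := mon_mem hF (SL_mem hθ) g
      obtain ⟨c, y, hy, hS⟩ := S_mem_span_sup hθ p a b
      have h1 := hlow (hF.mono (by push_cast; gcongr; exact_mod_cast hgw) (hF.mul_mem hS hmg))
      rw [sub_mul, smul_mul_assoc] at h1
      rw [← sub_add_cancel (S θ (p + 1) a b * mon θ g) (c • (y * mon θ g))]
      refine add_mem h1 ?_
      rcases hy with rfl | ⟨x, hxp, rfl⟩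
      · simp
      refine Submodule.smul_mem _ _ ?_
      obtain ⟨ε, hε, h2⟩ := SL_mul_mon hθ x g
      have h3 := hlow (hF.mono (by
        rw [hxp]; push_cast
        have : (pWeight g : ℤ) ≤ j := by exact_mod_cast hgw
        linarith) h2)
      rw [← sub_add_cancel (SL θ x * mon θ g) (ε • mon θ (g + Finsupp.single x 1))]
      refine add_mem h3 (Submodule.smul_mem _ _ ?_)
      have hw : pWeight (g + Finsupp.single x 1) ≤ p + 1 + j := by
        simp only [pWeight, map_add, weightOf_single] at *
        omega
      -- Inserting x can only spoil admissibility by repeating an odd label, and then the monomial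
      -- drops in weight.
      by_cases hv : IsPBWExp (g + Finsupp.single x 1)
      · exact Submodule.subset_span ⟨_, hv, hw, rfl⟩
      · simp only [IsPBWExp, not_forall, not_le] at hv
        obtain ⟨z, hz, hz2⟩ := hv
        refine hlow (hF.mono ?_ (mon_mem_of_two_le hθ hz hz2))
        push_cast
        have : (pWeight (g + Finsupp.single x 1) : ℤ) ≤ p + 1 + j := by exact_mod_cast hw
        linarith

end Monomials

end TwistedSuperYangian

namespace TwistedSuperYangian

open Polynomial

/-! ### The evaluation representation and graded tensor products -/

section Representations

variable {M N : ℕ} {C : Type*} [Ring C] [Algebra ℂ C]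

/-- The homomorphism from the superYangian determined by a family satisfying its relations. -/
def lift {t : ℕ → Fin (M + N) → Fin (M + N) → C} (ht : IsRTT t) : SuperYangian M N →ₐ[ℂ] C :=
  RingQuot.liftAlgHom ℂ ⟨FreeAlgebra.lift ℂ fun x => t x.1 x.2.1 x.2.2, by
    intro x y h
    cases h with
    | zero a b =>
      rw [FreeAlgebra.lift_ι_apply, ht.zero]
      split_ifs <;> simp
    | comm p q a b c d =>
      simp only [map_sub, map_mul, map_smul, FreeAlgebra.lift_ι_apply]
      exact ht.comm p q a b c d⟩

@[simp] theorem lift_T {t : ℕ → Fin (M + N) → Fin (M + N) → C} (ht : IsRTT t) (p : ℕ)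
    (a b : Fin (M + N)) : lift ht (T p a b) = t p a b := by
  refine (RingQuot.liftAlgHom_mkAlgHom_apply ℂ _ _ _).trans ?_
  simp

theorem IsRTT.map {t : ℕ → Fin (M + N) → Fin (M + N) → C} (ht : IsRTT t) {D : Type*} [Ring D]
    [Algebra ℂ D] (f : C →ₐ[ℂ] D) : IsRTT fun p a b => f (t p a b) where
  zero a b := by rw [ht.zero]; split_ifs <;> simp
  comm p q a b c d := by
    have := congrArg f (ht.comm p q a b c d)
    simpa only [map_sub, map_mul, map_smul] using this

theorem IsRTT.pi {ι : Type*} {t : ι → ℕ → Fin (M + N) → Fin (M + N) → C}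
    (ht : ∀ i, IsRTT (t i)) : IsRTT fun p a b i => t i p a b where
  zero a b := by
    funext i
    rw [(ht i).zero]
    split_ifs <;> rfl
  comm p q a b c d := funext fun i => (ht i).comm p q a b c d

/-- Each index a, b, c, d occurs once in every term, so a diagonal sign change preserves the
relations. Applied to each basis vector separately, it realises the graded tensor product by
ordinary matrices. -/
theorem IsRTT.conj {t : ℕ → Fin (M + N) → Fin (M + N) → C} (ht : IsRTT t)
    {e : Fin (M + N) → ℂ} (he : ∀ a, e a * e a = 1) :
    IsRTT fun p a b => (e a * e b) • t p a b where
  zero a b := by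
    rw [ht.zero]
    split_ifs with h
    · rw [h, he, one_smul]
    · simp
  comm p q a b c d := by
    have h := ht.comm p q a b c d
    simp only [smul_mul_smul_comm, smul_sub, smul_smul] at h ⊢
    generalize (-1 : ℂ) ^ (parity a * parity b + (parity a + parity b) * parity c) = r at *
    generalize (-1 : ℂ) ^ ((parity a + parity b) * (parity c + parity d)) = s at *
    linear_combination (norm := module) (e a * e b * e c * e d) • h

/-- The sign of a homogeneous element acting on a basis vector. -/
def vecSign (i a : Fin (M + N)) : ℂ := (-1) ^ (parity a * parity i)

theorem vecSign_mul_self (i a : Fin (M + N)) : vecSign i a * vecSign i a = 1 := by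
  rw [vecSign, ← pow_add, ← two_mul, Even.neg_one_pow (even_two_mul _)]

/-- The graded tensor product of a family with the identity of the vector representation. -/
def diagFam (t : ℕ → Fin (M + N) → Fin (M + N) → C) (p : ℕ) (a b : Fin (M + N)) :
    Matrix (Fin (M + N)) (Fin (M + N)) C :=
  Matrix.diagonal fun i => (vecSign i a * vecSign i b) • t p a b

theorem IsRTT.diag {t : ℕ → Fin (M + N) → Fin (M + N) → C} (ht : IsRTT t) :
    IsRTT (diagFam t) :=
  (IsRTT.pi fun i => ht.conj (vecSign_mul_self i)).map
    (Matrix.diagonalAlgHom (n := Fin (M + N)) ℂ)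

/-- The evaluation representation of `Y(M|N)` on `ℂ^{M|N}`, with polynomial parameter. -/
def evalFam (C : Type*) [Ring C] [Algebra ℂ C] :
    ℕ → Fin (M + N) → Fin (M + N) → Polynomial (Matrix (Fin (M + N)) (Fin (M + N)) C)
  | 0, a, b => if a = b then 1 else 0
  | p + 1, a, b => (-1 : ℂ) ^ parity b • (Polynomial.monomial p (Matrix.single a b 1))

theorem delta_gradedCommute (a b c d : Fin (M + N)) (X : C) :
    X * (if c = d then 1 else 0) -
      (-1 : ℂ) ^ ((parity a + parity b) * (parity c + parity d)) •
        ((if c = d then 1 else 0) * X) = 0 := by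
  split_ifs with h
  · rw [h, ← two_mul (parity d), Even.neg_one_pow ((even_two_mul _).mul_left _)]
    simp
  · simp

theorem delta_gradedCommute' (a b c d : Fin (M + N)) (X : C) :
    (if a = b then 1 else 0) * X -
      (-1 : ℂ) ^ ((parity a + parity b) * (parity c + parity d)) •
        (X * (if a = b then 1 else 0)) = 0 := by
  split_ifs with h
  · rw [h, ← two_mul (parity b), Even.neg_one_pow ((even_two_mul _).mul_right _)]
    simp
  · simp

theorem monomial_single_mul (p q : ℕ) (a b c d : Fin (M + N)) :
    (monomial p (Matrix.single a b (1 : C))) * (monomial q (Matrix.single c d 1)) =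
      if b = c then monomial (p + q) (Matrix.single a d 1) else 0 := by
  rw [monomial_mul_monomial]
  split_ifs with h
  · subst h; simp
  · simp [h]

/-- The supercommutator depends on p and q only through p + q, so in the defining relation the two
differences cancel as soon as both indices are positive. -/
theorem evalFam_commutator (p q : ℕ) (a b c d : Fin (M + N)) :
    evalFam C (p + 1) a b * evalFam C (q + 1) c d -
      (-1 : ℂ) ^ ((parity a + parity b) * (parity c + parity d)) •
        (evalFam C (q + 1) c d * evalFam C (p + 1) a b) =
    (-1 : ℂ) ^ (parity a * parity b + (parity a + parity b) * parity c) •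
      ((if c = b then evalFam C (p + q + 1) a d else 0) -
        (if a = d then evalFam C (p + q + 1) c b else 0)) := by
  have h1 : b = c → (-1 : ℂ) ^ parity b * (-1) ^ parity d =
      (-1 : ℂ) ^ (parity a * parity b + (parity a + parity b) * parity c) * (-1) ^ parity d := by
    rintro rfl
    rcases parity_eq a with pa | pa <;> rcases parity_eq b with pb | pb <;> norm_num [pa, pb]
  have h2 : d = a → (-1 : ℂ) ^ ((parity a + parity b) * (parity c + parity d)) *
      ((-1) ^ parity d * (-1) ^ parity b) =
      (-1 : ℂ) ^ (parity a * parity b + (parity a + parity b) * parity c) * (-1) ^ parity b := by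
    rintro rfl
    rcases parity_eq d with pa | pa <;> rcases parity_eq b with pb | pb <;>
      rcases parity_eq c with pc | pc <;> norm_num [pa, pb, pc]
  simp only [evalFam, smul_mul_smul_comm, monomial_single_mul, smul_smul, smul_sub, smul_ite,
    smul_zero, add_comm q p, eq_comm (a := c) (b := b), eq_comm (a := a) (b := d)]
  split_ifs with e1 e2 e2
  · rw [h1 e1, h2 e2]
  · rw [h1 e1]
  · rw [h2 e2]
  · rfl

theorem isRTT_evalFam : IsRTT (evalFam (M := M) (N := N) C) where
  zero _ _ := rfl
  comm p q a b c d := by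
    have h0 : ∀ a b : Fin (M + N), evalFam C 0 a b = if a = b then 1 else 0 := fun _ _ => rfl
    rcases p with _ | p <;> rcases q with _ | q
    · simp only [h0, sub_self, smul_zero, delta_gradedCommute, delta_gradedCommute']
    · rw [evalFam_commutator, h0 a b, delta_gradedCommute']
      simp only [h0, sub_zero, ite_mul, _root_.one_mul, zero_mul, mul_ite,
        mul_one, mul_zero, zero_add]
    · rw [evalFam_commutator, h0 c d, delta_gradedCommute]
      simp only [h0, zero_sub, ite_mul, _root_.one_mul, zero_mul, mul_ite,
        mul_one, mul_zero, add_zero]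
      rw [← smul_neg, neg_sub]
    · rw [evalFam_commutator, evalFam_commutator, add_right_comm p 1 q, ← add_assoc p q 1, sub_self]
      simp only [evalFam, smul_mul_smul_comm, monomial_single_mul, smul_smul, add_comm q p]
      simp

theorem evalFam_mul_diagFam (t : ℕ → Fin (M + N) → Fin (M + N) → C) (p q : ℕ)
    (a b c d : Fin (M + N)) :
    evalFam C p a b * Polynomial.C (diagFam t q c d) =
      (-1 : ℂ) ^ ((parity a + parity b) * (parity c + parity d)) •
        (Polynomial.C (diagFam t q c d) * evalFam C p a b) := by
  rcases p with _ | p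
  · simp only [evalFam]
    split_ifs with h
    · rw [h, ← two_mul, mul_assoc, Even.neg_one_pow (even_two_mul _)]
      simp
    · simp
  · simp only [evalFam, smul_mul_assoc, mul_smul_comm, monomial_mul_C, C_mul_monomial, smul_smul]
    rw [mul_comm ((-1 : ℂ) ^ ((parity a + parity b) * _)), mul_smul]
    congr 1
    rw [Polynomial.smul_monomial]
    congr 1
    ext i j
    simp only [diagFam, Matrix.mul_diagonal, Matrix.diagonal_mul, Matrix.smul_apply,
      Matrix.single_apply, vecSign]
    split_ifs with h
    · obtain ⟨rfl, rfl⟩ := h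
      rw [_root_.one_mul, mul_one, smul_smul]
      congr 1
      rcases parity_eq a with pa | pa <;> rcases parity_eq b with pb | pb <;>
        rcases parity_eq c with pc | pc <;> rcases parity_eq d with pd | pd <;>
        norm_num [pa, pb, pc, pd]
    · simp

end Representations

end TwistedSuperYangian

namespace TwistedSuperYangian

open Polynomial

/-! ### Filtered polynomials with matrix coefficients -/

section FiltrationMaps

variable {ι A B : Type*} [Ring A] [Algebra ℂ A] [Ring B] [Algebra ℂ B]

theorem map_mem_of_mem_filt {g : ι → A} {w : ι → ℕ} {G : ℤ → Submodule ℂ B} (hG : IsFilt G)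
    (φ : A →ₐ[ℂ] B) (h : ∀ x, φ (g x) ∈ G (w x)) {n : ℤ} {x : A} (hx : x ∈ filt g w n) :
    φ x ∈ G n := by
  refine Submodule.span_induction (p := fun z _ => φ z ∈ G n) ?_ (by simp)
    (fun x y _ _ hx hy => by rw [map_add]; exact add_mem hx hy)
    (fun c x _ hx => by rw [map_smul]; exact Submodule.smul_mem _ _ hx) hx
  rintro _ ⟨l, hl, rfl⟩
  refine hG.mono hl ?_
  clear hl
  induction l with
  | nil => simpa using hG.one_mem le_rfl
  | cons a l ih =>
    simp only [List.map_cons, List.prod_cons, List.sum_cons, map_mul]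
    exact_mod_cast hG.mul_mem (h a) ih

/-- Polynomials with matrix coefficients, filtered so that the variable has degree `2`. -/
def polyFilt {I : Type*} (F : ℤ → Submodule ℂ A) [Fintype I] [DecidableEq I] (n : ℤ) :
    Submodule ℂ (Polynomial (Matrix I I A)) where
  carrier := {P | ∀ (q : ℕ) i j, P.coeff q i j ∈ F (n - 2 * q)}
  add_mem' ha hb q i j := by
    rw [coeff_add, Matrix.add_apply]
    exact add_mem (ha q i j) (hb q i j)
  zero_mem' q i j := by simp
  smul_mem' c _ h q i j := by
    rw [coeff_smul, Matrix.smul_apply]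
    exact Submodule.smul_mem _ _ (h q i j)

variable {I : Type*} [Fintype I] [DecidableEq I] {F : ℤ → Submodule ℂ A}

theorem C_mem_polyFilt {m : Matrix I I A} {n : ℤ} (h : ∀ i j, m i j ∈ F n) :
    C m ∈ polyFilt F n := by
  rintro (_ | q) i j
  · simpa using h i j
  · simp [coeff_C]

theorem isFilt_polyFilt (hF : IsFilt F) : IsFilt (polyFilt (I := I) F) where
  mono h P hP q i j := hF.mono (by linarith) (hP q i j)
  one_mem h := by
    rw [← C_1]
    refine C_mem_polyFilt fun i j => ?_
    rw [Matrix.one_apply]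
    split_ifs
    · exact hF.one_mem h
    · exact zero_mem _
  mul_mem {m n P Q} hP hQ q i j := by
    rw [coeff_mul, Matrix.sum_apply]
    refine sum_mem fun r hr => ?_
    rw [Matrix.mul_apply]
    refine sum_mem fun k _ => ?_
    have h := hF.mul_mem (hP r.1 i k) (hQ r.2 k j)
    rw [Finset.HasAntidiagonal.mem_antidiagonal] at hr
    convert h using 2
    rw [← hr]
    push_cast
    ring

theorem monomial_mem_polyFilt (hF : IsFilt F) (p : ℕ) (i j : I) :
    monomial p (Matrix.single i j (1 : A)) ∈ polyFilt F (2 * p) := by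
  intro q k l
  rw [coeff_monomial]
  split_ifs with h
  · subst h
    rw [Matrix.single_apply]
    split_ifs
    · exact hF.one_mem (by simp)
    · exact zero_mem _
  · simp

end FiltrationMaps

/-! ### Difference operators from the coproduct -/

section Coaction

variable {M N : ℕ}

/-- The filtration of the superYangian in which `T_{(p)}` has degree `2 * p - 1`. -/
def filtT : ℤ → Submodule ℂ (SuperYangian M N) :=
  filt (fun x : ℕ × Fin (M + N) × Fin (M + N) => T (x.1 + 1) x.2.1 x.2.2) (fun x => 2 * x.1 + 1)

theorem isFilt_filtT : IsFilt (filtT (M := M) (N := N)) := isFilt_filt _ _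

theorem T_succ_mem (p : ℕ) (a b : Fin (M + N)) : T (p + 1) a b ∈ filtT (2 * p + 1) := by
  have := gen_mem_filt (fun x : ℕ × Fin (M + N) × Fin (M + N) => T (x.1 + 1) x.2.1 x.2.2)
    (fun x => 2 * x.1 + 1) (p, a, b)
  exact_mod_cast this

/-- The action of the superYangian on `ℂ^{M|N} ⊗ Y(M|N)`, trivial on the first factor. -/
def iotaHom : SuperYangian M N →ₐ[ℂ] Matrix (Fin (M + N)) (Fin (M + N)) (SuperYangian M N) :=
  lift isRTT_T.diag

/-- The coproduct followed by the evaluation representation in one factor. -/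
def coactHom : SuperYangian M N →ₐ[ℂ]
    Polynomial (Matrix (Fin (M + N)) (Fin (M + N)) (SuperYangian M N)) :=
  lift ((isRTT_T.diag.map CAlgHom).mul isRTT_evalFam (evalFam_mul_diagFam T))

/-- The part of the coaction which is not trivial on the vector representation. -/
def delta : SuperYangian M N →ₗ[ℂ]
    Polynomial (Matrix (Fin (M + N)) (Fin (M + N)) (SuperYangian M N)) :=
  coactHom.toLinearMap - (CAlgHom.comp iotaHom).toLinearMap

theorem delta_apply (w : SuperYangian M N) : delta w = coactHom w - C (iotaHom w) := rfl

theorem delta_one : delta (1 : SuperYangian M N) = 0 := by simp [delta_apply]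

/-- A difference of two homomorphisms is a derivation up to the product of the differences; since
`delta` lowers weight by one, that product is negligible. -/
theorem delta_mul (v w : SuperYangian M N) :
    delta (v * w) = delta v * delta w + C (iotaHom v) * delta w + delta v * C (iotaHom w) := by
  simp only [delta_apply, map_mul, C_mul, sub_mul, mul_sub]
  abel

theorem iotaHom_T (p : ℕ) (a b : Fin (M + N)) : iotaHom (T p a b) = diagFam T p a b :=
  lift_T _ _ _ _

theorem diagFam_mem (p : ℕ) (a b : Fin (M + N)) :
    C (diagFam T (p + 1) a b) ∈ polyFilt (filtT (M := M) (N := N)) (2 * p + 1) := by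
  refine C_mem_polyFilt fun i j => ?_
  rw [diagFam, Matrix.diagonal_apply]
  split_ifs
  · exact Submodule.smul_mem _ _ (T_succ_mem p a b)
  · exact zero_mem _

theorem iotaHom_mem {n : ℤ} {w : SuperYangian M N} (hw : w ∈ filtT n) :
    C (iotaHom w) ∈ polyFilt filtT n :=
  map_mem_of_mem_filt (isFilt_polyFilt isFilt_filtT) (CAlgHom.comp iotaHom)
    (fun x => by
      have := diagFam_mem x.1 x.2.1 x.2.2
      rw [← iotaHom_T] at this
      exact_mod_cast this) hw

theorem evalFam_mem (p : ℕ) (a b : Fin (M + N)) :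
    evalFam (SuperYangian M N) (p + 1) a b ∈ polyFilt filtT (2 * p) :=
  Submodule.smul_mem _ _ (monomial_mem_polyFilt isFilt_filtT p a b)

/-- In the coproduct only the term with T_{(0)} in the Yangian factor has weight 2p. A term T_{(r)}
z^{s} with r ≥ 1 and r + s = p has weight 2r-1+2s = 2p-1. -/
theorem delta_T_mem (p : ℕ) (a b : Fin (M + N)) :
    delta (T (p + 1) a b) - (-1 : ℂ) ^ parity b • monomial p (Matrix.single a b 1) ∈
      polyFilt (filtT (M := M) (N := N)) (2 * p - 1) := by
  have hF := isFilt_polyFilt (I := Fin (M + N)) (isFilt_filtT (M := M) (N := N))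
  have e1 : coactHom (T (p + 1) a b) = ∑ c, (C (diagFam T (p + 1) a c) *
      (if c = b then 1 else 0) + ∑ r ∈ Finset.HasAntidiagonal.antidiagonal p,
        C (diagFam T r.1 a c) * evalFam (SuperYangian M N) (r.2 + 1) c b) := by
    refine (lift_T _ _ _ _).trans ?_
    simp only [mulFam, Finset.Nat.sum_antidiagonal_succ']
    rfl
  have e2 : evalFam (SuperYangian M N) (p + 1) a b =
      ∑ c, C (diagFam T 0 a c) * evalFam (SuperYangian M N) (p + 1) c b := by
    rw [Finset.sum_eq_single a]
    · rw [isRTT_T.diag.zero]; simp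
    · intro c _ h
      rw [isRTT_T.diag.zero]; simp [h.symm]
    · simp
  change _ - evalFam (SuperYangian M N) (p + 1) a b ∈ _
  rw [delta_apply, e1, iotaHom_T, Finset.sum_add_distrib]
  simp only [mul_ite, mul_one, mul_zero, Finset.sum_ite_eq', Finset.mem_univ, if_true]
  rw [add_sub_cancel_left, e2, ← Finset.sum_sub_distrib]
  refine sum_mem fun c _ => ?_
  rcases p with _ | p
  · simp
  rw [Finset.Nat.sum_antidiagonal_succ, add_sub_cancel_left]
  refine sum_mem fun r hr => ?_
  rw [Finset.HasAntidiagonal.mem_antidiagonal] at hr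
  refine hF.mono ?_ (hF.mul_mem (diagFam_mem r.1 a c) (evalFam_mem r.2 c b))
  rw [← hr]
  push_cast
  linarith

theorem delta_mem {n : ℤ} {w : SuperYangian M N} (hw : w ∈ filtT n) :
    delta w ∈ polyFilt filtT (n - 1) := by
  have hF := isFilt_polyFilt (I := Fin (M + N)) (isFilt_filtT (M := M) (N := N))
  refine Submodule.span_induction (p := fun z _ => delta z ∈ polyFilt filtT (n - 1)) ?_ (by simp)
    (fun x y _ _ hx hy => by rw [map_add]; exact add_mem hx hy)
    (fun c x _ hx => by rw [map_smul]; exact Submodule.smul_mem _ _ hx) hw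
  rintro _ ⟨l, hl, rfl⟩
  refine hF.mono (sub_le_sub_right hl 1) ?_
  clear hl hw
  induction l with
  | nil => simp [delta_one]
  | cons x l ih =>
    simp only [List.map_cons, List.prod_cons, List.sum_cons]
    have h1 := T_succ_mem x.1 x.2.1 x.2.2
    have h2 : (l.map fun x => T (x.1 + 1) x.2.1 x.2.2).prod ∈
        filtT (M := M) (N := N) ((l.map fun x => 2 * x.1 + 1).sum : ℕ) :=
      Submodule.subset_span ⟨l, le_rfl, rfl⟩
    have h3 : delta (T (x.1 + 1) x.2.1 x.2.2) ∈ polyFilt (filtT (M := M) (N := N)) (2 * x.1) := by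
      rw [← sub_add_cancel (delta _) (evalFam (SuperYangian M N) (x.1 + 1) x.2.1 x.2.2)]
      exact add_mem (hF.mono (by linarith) (delta_T_mem x.1 x.2.1 x.2.2)) (evalFam_mem _ _ _)
    rw [delta_mul]
    refine add_mem (add_mem (hF.mono ?_ (hF.mul_mem h3 ih))
      (hF.mono ?_ (hF.mul_mem (iotaHom_mem h1) ih)))
      (hF.mono ?_ (hF.mul_mem h3 (iotaHom_mem h2))) <;> push_cast <;> linarith

/-- The matrix coefficients of `delta`. -/
def del (q : ℕ) (i j : Fin (M + N)) : SuperYangian M N →ₗ[ℂ] SuperYangian M N where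
  toFun w := (delta w).coeff q i j
  map_add' := by simp
  map_smul' := by simp

theorem del_apply (q : ℕ) (i j : Fin (M + N)) (w : SuperYangian M N) :
    del q i j w = (delta w).coeff q i j := rfl

theorem del_mem {n : ℤ} {w : SuperYangian M N} (hw : w ∈ filtT n) (q : ℕ) (i j : Fin (M + N)) :
    del q i j w ∈ filtT (n - 1 - 2 * q) := delta_mem hw q i j

/-- Homogeneity of an element with respect to the parity `k`. -/
def IsHomog (k : ℕ) (w : SuperYangian M N) : Prop :=
  iotaHom w = Matrix.diagonal fun i => (-1 : ℂ) ^ (k * parity i) • w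

theorem isHomog_one : IsHomog 0 (1 : SuperYangian M N) := by
  simp [IsHomog]

theorem IsHomog.mul {k l : ℕ} {v w : SuperYangian M N} (hv : IsHomog k v) (hw : IsHomog l w) :
    IsHomog (k + l) (v * w) := by
  unfold IsHomog at *
  rw [map_mul, hv, hw, Matrix.diagonal_mul_diagonal]
  simp only [smul_mul_smul_comm, ← pow_add, add_mul]

theorem isHomog_T (p : ℕ) (a b : Fin (M + N)) : IsHomog (parity a + parity b) (T p a b) := by
  unfold IsHomog
  rw [iotaHom_T, diagFam]
  simp only [vecSign, ← pow_add, add_mul]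

theorem IsHomog.smul {k : ℕ} {w : SuperYangian M N} (hw : IsHomog k w) (c : ℂ) :
    IsHomog k (c • w) := by
  unfold IsHomog at *
  rw [map_smul, hw, ← Matrix.diagonal_smul]
  congr 1
  funext i
  simp [smul_comm c]

theorem IsHomog.sum {κ : Type*} {k : ℕ} {s : Finset κ} {w : κ → SuperYangian M N}
    (hw : ∀ i ∈ s, IsHomog k (w i)) : IsHomog k (∑ i ∈ s, w i) := by
  unfold IsHomog at *
  rw [map_sum, Finset.sum_congr rfl hw]
  ext i j
  simp [Matrix.sum_apply, Matrix.diagonal_apply, Finset.smul_sum]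

theorem IsHomog.congr {k l : ℕ} {w : SuperYangian M N} (hw : IsHomog k w)
    (h : Even k ↔ Even l) : IsHomog l w := by
  unfold IsHomog at *
  rw [hw]
  congr 1
  funext i
  congr 1
  apply neg_one_pow_congr
  simp only [Nat.even_mul, h]

theorem isHomog_S (θ : Fin (M + N) → ℂ) (p : ℕ) (a b : Fin (M + N)) :
    IsHomog (parity a + parity b) (S θ p a b) := by
  unfold S
  refine IsHomog.sum fun c _ => IsHomog.sum fun k _ => ?_
  refine ((isHomog_T _ a c).mul ((isHomog_T _ (bar b) (bar c)).smul _)).congr ?_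
  simp only [parity_bar, Nat.even_add]
  tauto

/-- The graded Leibniz rule to leading order. On homogeneous elements the trivial action is diagonal
with signs, so the matrix entries do not mix. -/
theorem del_mul {k l : ℕ} {m n : ℤ} {v w : SuperYangian M N} (hv : IsHomog k v)
    (hw : IsHomog l w) (hvm : v ∈ filtT m) (hwn : w ∈ filtT n) (q : ℕ) (i j : Fin (M + N)) :
    del q i j (v * w) - ((-1 : ℂ) ^ (k * parity i) • (v * del q i j w) +
      (-1 : ℂ) ^ (l * parity j) • (del q i j v * w)) ∈ filtT (m + n - 2 - 2 * q) := by
  have h := (isFilt_polyFilt isFilt_filtT).mul_mem (delta_mem hvm) (delta_mem hwn) q i j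
  rw [show m - 1 + (n - 1) - 2 * (q : ℤ) = m + n - 2 - 2 * q by ring] at h
  convert h using 1
  rw [del_apply, delta_mul, hv, hw]
  simp [del_apply, Matrix.diagonal_mul, Matrix.mul_diagonal]

end Coaction

end TwistedSuperYangian

namespace TwistedSuperYangian

open Polynomial

/-! ### Leading parts of the S-generators -/

section LeadingTerms

variable {M N : ℕ}

theorem tauFam_T_succ_mem (θ : Fin (M + N) → ℂ) (p : ℕ) (a b : Fin (M + N)) :
    tauFam θ T (p + 1) a b ∈ filtT (2 * p + 1) :=
  Submodule.smul_mem _ _ (T_succ_mem p _ _)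

/-- The two extreme terms of the convolution are linear in T; a middle term, with both indices
positive, loses one unit because each factor has the odd weight 2r-1. -/
theorem S_sub_mem {θ : Fin (M + N) → ℂ} (hθ : IsTwist θ) (p : ℕ) (a b : Fin (M + N)) :
    S θ (p + 1) a b - (T (p + 1) a b + twistSign θ (p + 1) a b • T (p + 1) (bar b) (bar a)) ∈
      filtT (2 * p) := by
  have hF := isFilt_filtT (M := M) (N := N)
  have e1 : twistSign θ (p + 1) a b • T (p + 1) (bar b) (bar a) =
      ∑ c, T 0 a c * tauFam θ T (p + 1) c b := by
    rw [Finset.sum_eq_single a]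
    · rw [isRTT_T.zero, if_pos rfl, _root_.one_mul]; rfl
    · intro c _ h
      rw [isRTT_T.zero, if_neg h.symm, zero_mul]
    · simp
  have e2 : T (p + 1) a b = ∑ c, T (p + 1) a c * tauFam θ T 0 c b := by
    rw [Finset.sum_eq_single b]
    · rw [(isRTT_T.tau hθ).zero, if_pos rfl, mul_one]
    · intro c _ h
      rw [(isRTT_T.tau hθ).zero, if_neg h, mul_zero]
    · simp
  rw [S_eq_mulFam, e1]
  conv in T (p + 1) a b => rw [e2]
  unfold mulFam
  rw [← Finset.sum_add_distrib, ← Finset.sum_sub_distrib]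
  refine sum_mem fun c _ => ?_
  rw [Finset.Nat.sum_antidiagonal_succ, add_comm (T (p + 1) a c * _), add_sub_add_left_eq_sub]
  rcases p with _ | p
  · simp
  rw [Finset.Nat.sum_antidiagonal_succ', add_sub_cancel_left]
  refine sum_mem fun r hr => ?_
  rw [Finset.HasAntidiagonal.mem_antidiagonal] at hr
  refine hF.mono ?_ (hF.mul_mem (T_succ_mem r.1 a c) (tauFam_T_succ_mem θ r.2 c b))
  rw [← hr]
  push_cast
  linarith

theorem S_succ_mem_filtT {θ : Fin (M + N) → ℂ} (hθ : IsTwist θ) (p : ℕ) (a b : Fin (M + N)) :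
    S θ (p + 1) a b ∈ filtT (2 * p + 1) := by
  have h := isFilt_filtT.mono (show (2 * p : ℤ) ≤ 2 * p + 1 by omega) (S_sub_mem hθ p a b)
  have h2 := add_mem (T_succ_mem p a b)
    (Submodule.smul_mem _ (twistSign θ (p + 1) a b) (T_succ_mem p (bar b) (bar a)))
  have := add_mem h h2
  rwa [sub_add_cancel] at this

theorem delta_S_mem {θ : Fin (M + N) → ℂ} (hθ : IsTwist θ) (p : ℕ) (a b : Fin (M + N)) :
    delta (S θ (p + 1) a b) - ((-1 : ℂ) ^ parity b • monomial p (Matrix.single a b 1) +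
      (twistSign θ (p + 1) a b * (-1 : ℂ) ^ parity a) •
        monomial p (Matrix.single (bar b) (bar a) 1)) ∈ polyFilt filtT (2 * p - 1) := by
  have h1 := delta_mem (S_sub_mem hθ p a b)
  have h2 := delta_T_mem p a b
  have h3 := Submodule.smul_mem _ (twistSign θ (p + 1) a b) (delta_T_mem p (bar b) (bar a))
  have := add_mem (add_mem h1 h2) h3
  convert this using 1
  rw [map_sub, map_add, map_smul, parity_bar, smul_sub, smul_smul]
  abel

end LeadingTerms

/-! ### Partial derivatives on ordered monomials -/

section Independence

variable {M n : ℕ}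

/-- The weight of a PBW generator in the filtration `filtT`. -/
def tw (x : PBWLabel M n) : ℕ := 2 * (x.p - 1) + 1

/-- The operator of leading behaviour `∂ / ∂ S_x`. -/
def delL (x : PBWLabel M n) : SuperYangian M (2 * n) →ₗ[ℂ] SuperYangian M (2 * n) :=
  del (x.p - 1) x.i x.j

/-- The value of `delL x` on the generator with label `x`. -/
def lam (x : PBWLabel M n) : ℂ :=
  (-1) ^ parity x.j + if bar x.j = x.i then (-1) ^ parity x.i else 0

theorem lam_ne_zero (x : PBWLabel M n) : lam x ≠ 0 := by
  unfold lam
  split_ifs with h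
  · rw [← h, parity_bar]
    rcases parity_eq x.j with h | h <;> norm_num [h]
  · simp

theorem bar_val (c : Fin (M + 2 * n)) : (bar c).val =
    if c.val < M then M - 1 - c.val else 2 * M + 2 * n - 1 - c.val := by
  unfold bar; split_ifs <;> rfl

/-- The index set contains at most one element of each orbit of (i,j) ↦ (j̄,ī), so the second matrix
unit in the leading part of a generator never interferes with another label. -/
theorem PBWLabel.eq_of_bar {x y : PBWLabel M n} (hp : x.p = y.p) (hi : bar y.j = x.i)
    (hj : bar y.i = x.j) : x = y := by
  obtain ⟨p, i, j, pos, mem⟩ := x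
  obtain ⟨p', i', j', pos', mem'⟩ := y
  have h1 := i'.isLt
  have h2 := j'.isLt
  simp only at hp hi hj
  subst hp hi hj
  have : bar j' = i' ∧ bar i' = j' := by
    simp only [Fin.ext_iff, bar_val, IsPBWIndex, Nat.even_iff, Nat.odd_iff] at *
    split_ifs at * <;> omega
  simp [this]

/-- The parity conditions on p keep exactly those self-conjugate labels for which the two leading
terms add instead of cancelling. -/
theorem PBWLabel.twistSign_eq_one {θ : Fin (M + 2 * n) → ℂ} (hθ : IsTwist θ) (x : PBWLabel M n)
    (h : bar x.j = x.i) : twistSign θ x.p x.i x.j = 1 := by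
  obtain ⟨p, i, j, pos, mem⟩ := x
  simp only at h ⊢
  subst h
  have h2 := j.isLt
  have he : Even (parity j + p) := by
    simp only [bar_val, IsPBWIndex, Nat.even_iff, Nat.odd_iff, parity] at *
    split_ifs at * <;> omega
  rw [← Even.neg_one_pow he, twistSign, hθ.bar_eq, parity_bar, pow_add]
  rcases parity_eq j with pa | pa <;> rcases (hθ j).1 with ha | ha <;> simp [pa, ha]

variable [LinearOrder (PBWLabel M n)]

theorem delL_SL {θ : Fin (M + 2 * n) → ℂ} (hθ : IsTwist θ) (x y : PBWLabel M n) :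
    delL x (SL θ y) - (if x = y then algebraMap ℂ (SuperYangian M (2 * n)) (lam x) else 0) ∈
      filtT ((tw y : ℤ) - tw x - 1) := by
  have hy : y.p - 1 + 1 = y.p := Nat.sub_add_cancel y.pos
  have h := delta_S_mem hθ (y.p - 1) y.i y.j (x.p - 1) x.i x.j
  rw [hy] at h
  have e : (2 * ((y.p - 1 : ℕ) : ℤ) - 1 - 2 * ((x.p - 1 : ℕ) : ℤ)) = (tw y : ℤ) - tw x - 1 := by
    simp only [tw]; push_cast; ring
  rw [e] at h
  convert h using 1
  rw [coeff_sub, Matrix.sub_apply]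
  congr 1
  rw [coeff_add, coeff_smul, coeff_smul, coeff_monomial, coeff_monomial, Matrix.add_apply,
    Matrix.smul_apply, Matrix.smul_apply]
  by_cases hp : y.p - 1 = x.p - 1
  · have hp' : x.p = y.p := by have := x.pos; have := y.pos; omega
    rw [if_pos hp, if_pos hp, Matrix.single_apply, Matrix.single_apply]
    by_cases hxy : x = y
    · subst hxy
      rw [if_pos rfl, if_pos ⟨rfl, rfl⟩, lam, map_add, Algebra.smul_def, mul_one]
      congr 1
      by_cases hb : bar x.j = x.i
      · rw [if_pos hb, if_pos ⟨hb, by rw [← hb, bar_bar]⟩, x.twistSign_eq_one hθ hb,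
          Algebra.smul_def, mul_one, _root_.one_mul]
      · rw [if_neg hb, if_neg (fun h => hb h.1), map_zero, smul_zero]
    · rw [if_neg hxy, if_neg, if_neg, smul_zero, smul_zero, add_zero]
      · exact fun hb => hxy (PBWLabel.eq_of_bar hp' hb.1 hb.2)
      · rintro ⟨h1, h2⟩
        apply hxy
        obtain ⟨p, i, j, pos, mem⟩ := x
        obtain ⟨p', i', j', pos', mem'⟩ := y
        simp only at hp' h1 h2
        subst hp' h1 h2
        rfl
  · have hxy : x ≠ y := by rintro rfl; exact hp rfl
    simp [hp, hxy]

theorem SL_mem_filtT {θ : Fin (M + 2 * n) → ℂ} (hθ : IsTwist θ) (x : PBWLabel M n) :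
    SL θ x ∈ filtT (tw x) := by
  have := S_succ_mem_filtT hθ (x.p - 1) x.i x.j
  rw [Nat.sub_add_cancel x.pos] at this
  simpa [tw, SL] using this

/-- The weight of an exponent in the filtration `filtT`. -/
def tWeight : (PBWLabel M n →₀ ℕ) →+ ℕ := weightOf tw

/-- The parity of an ordered monomial. -/
def monParity : (PBWLabel M n →₀ ℕ) →+ ℕ := weightOf fun x => parity x.i + parity x.j

theorem isHomog_mon (θ : Fin (M + 2 * n) → ℂ) (f : PBWLabel M n →₀ ℕ) :
    IsHomog (monParity f) (mon θ f) := by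
  induction f using mon_induction with
  | h0 => simpa using isHomog_one
  | h1 f x hx ih =>
    rw [mon_add_single θ hx, map_add, monParity, weightOf_single, add_comm]
    exact (isHomog_S θ x.p x.i x.j).mul ih

theorem mon_mem_filtT {θ : Fin (M + 2 * n) → ℂ} (hθ : IsTwist θ) (f : PBWLabel M n →₀ ℕ) :
    mon θ f ∈ filtT (tWeight f) := mon_mem isFilt_filtT (SL_mem_filtT hθ) f

theorem delL_SL_mul_mon {θ : Fin (M + 2 * n) → ℂ} (hθ : IsTwist θ) (x y : PBWLabel M n)
    (f : PBWLabel M n →₀ ℕ) :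
    delL x (SL θ y * mon θ f) -
      ((-1 : ℂ) ^ ((parity y.i + parity y.j) * parity x.i) • (SL θ y * delL x (mon θ f)) +
        (if x = y then (lam x * (-1 : ℂ) ^ (monParity f * parity x.j)) • mon θ f else 0)) ∈
      filtT ((tw y : ℤ) + tWeight f - tw x - 1) := by
  have hF := isFilt_filtT (M := M) (N := 2 * n)
  have h1 := del_mul (isHomog_S θ y.p y.i y.j) (isHomog_mon θ f) (SL_mem_filtT hθ y)
    (mon_mem_filtT hθ f) (x.p - 1) x.i x.j
  have h2 := Submodule.smul_mem _ ((-1 : ℂ) ^ (monParity f * parity x.j))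
    (hF.mul_mem (delL_SL hθ x y) (mon_mem_filtT hθ f))
  have h3 := add_mem (hF.mono (n := (tw y : ℤ) + tWeight f - tw x - 1) ?_ h1)
    (hF.mono (n := (tw y : ℤ) + tWeight f - tw x - 1) ?_ h2)
  · convert h3 using 1
    change _ = _ + (-1 : ℂ) ^ (monParity f * parity x.j) •
      ((del (x.p - 1) x.i x.j (S θ y.p y.i y.j) - _) * mon θ f)
    rw [sub_mul, smul_sub]
    have e : (-1 : ℂ) ^ (monParity f * parity x.j) •
        ((if x = y then (algebraMap ℂ (SuperYangian M (2 * n))) (lam x) else 0) * mon θ f) =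
        if x = y then (lam x * (-1 : ℂ) ^ (monParity f * parity x.j)) • mon θ f else 0 := by
      split_ifs
      · rw [← Algebra.smul_def, smul_smul, mul_comm (lam x)]
      · simp
    rw [e]
    change del (x.p - 1) x.i x.j (S θ y.p y.i y.j * mon θ f) - ((-1 : ℂ) ^ _ •
      (S θ y.p y.i y.j * del (x.p - 1) x.i x.j (mon θ f)) + _) = _
    abel
  · simp only [tw]; push_cast; linarith
  · linarith

/-- By the Leibniz rule every term differentiates a generator with a label other than x, which
contributes only lower weight. -/
theorem delL_mon_mem {θ : Fin (M + 2 * n) → ℂ} (hθ : IsTwist θ) (x : PBWLabel M n)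
    (f : PBWLabel M n →₀ ℕ) (hx : f x = 0) :
    delL x (mon θ f) ∈ filtT ((tWeight f : ℤ) - tw x - 1) := by
  have hF := isFilt_filtT (M := M) (N := 2 * n)
  induction f using mon_induction with
  | h0 =>
    rw [mon_zero, delL, del_apply, delta_one]
    simp
  | h1 f y hy ih =>
    rw [Finsupp.add_apply, Nat.add_eq_zero_iff] at hx
    have hxy : x ≠ y := by rintro rfl; simp at hx
    have h1 := delL_SL_mul_mon hθ x y f
    rw [if_neg hxy, add_zero] at h1
    have h2 := Submodule.smul_mem _ ((-1 : ℂ) ^ ((parity y.i + parity y.j) * parity x.i))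
      (hF.mul_mem (SL_mem_filtT hθ y) (ih hx.1))
    rw [mon_add_single θ hy, ← sub_add_cancel (delL x _) ((-1 : ℂ) ^ _ • _)]
    simp only [tWeight, map_add, weightOf_single] at *
    exact add_mem (hF.mono (by push_cast; linarith) h1) (hF.mono (by push_cast; linarith) h2)

/-- The power rule: an even generator passes the operator without sign, giving k+1 equal terms. For
an odd one successive terms would alternate in sign, hence the restriction to k = 0. -/
theorem delL_mon_add_single {θ : Fin (M + 2 * n) → ℂ} (hθ : IsTwist θ) (x : PBWLabel M n)
    (f : PBWLabel M n →₀ ℕ) (hx : ∀ y ∈ f.support, x < y) (k : ℕ)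
    (hk : parity x.i ≠ parity x.j → k = 0) :
    delL x (mon θ (f + Finsupp.single x (k + 1))) -
      ((k + 1 : ℂ) * (lam x * (-1 : ℂ) ^ (monParity f * parity x.j))) •
        mon θ (f + Finsupp.single x k) ∈
      filtT ((tWeight (f + Finsupp.single x k) : ℤ) - 1) := by
  have hF := isFilt_filtT (M := M) (N := 2 * n)
  have hle : ∀ k, ∀ y ∈ (f + Finsupp.single x k).support, x ≤ y := fun k z hz => by
    rcases Finset.mem_union.1 (Finsupp.support_add hz) with h | h
    · exact (hx z h).le
    · rw [Finset.mem_singleton.1 (Finsupp.support_single_subset h)]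
  have hsucc : ∀ k, mon θ (f + Finsupp.single x (k + 1)) =
      SL θ x * mon θ (f + Finsupp.single x k) := fun k => by
    rw [Finsupp.single_add, ← add_assoc, mon_add_single θ (hle k)]
  have hfx : f x = 0 := by
    by_contra h
    exact lt_irrefl x (hx x (Finsupp.mem_support_iff.2 h))
  induction k with
  | zero =>
    have h1 := delL_SL_mul_mon hθ x x f
    have h2 := Submodule.smul_mem _ ((-1 : ℂ) ^ ((parity x.i + parity x.j) * parity x.i))
      (hF.mul_mem (SL_mem_filtT hθ x) (delL_mon_mem hθ x f hfx))
    rw [if_pos rfl] at h1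
    rw [hsucc 0]
    simp only [Finsupp.single_zero, add_zero, Nat.cast_zero, zero_add, _root_.one_mul]
    have h3 := add_mem (hF.mono (n := (tWeight f : ℤ) - 1) (by linarith) h1)
      (hF.mono (n := (tWeight f : ℤ) - 1) (by linarith) h2)
    convert h3 using 1
    abel
  | succ k ih =>
    have hp : parity x.i = parity x.j := by
      by_contra h
      exact absurd (hk h) (by simp)
    have ih := ih fun h => absurd hp h
    have h1 := delL_SL_mul_mon hθ x x (f + Finsupp.single x (k + 1))
    rw [if_pos rfl] at h1
    have h2 := hF.mul_mem (SL_mem_filtT hθ x) ih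
    have s1 : (-1 : ℂ) ^ ((parity x.i + parity x.j) * parity x.i) = 1 := by
      rw [hp, ← two_mul, Even.neg_one_pow ((even_two_mul _).mul_right _)]
    have s2 : (-1 : ℂ) ^ (monParity (f + Finsupp.single x (k + 1)) * parity x.j) =
        (-1 : ℂ) ^ (monParity f * parity x.j) := by
      apply neg_one_pow_congr
      rw [map_add]
      have : Even (monParity (Finsupp.single x (k + 1))) := by
        simp only [monParity, weightOf, Finsupp.liftAddHom_apply_single, AddMonoidHom.coe_mulRight]
        rw [hp, ← two_mul]
        exact (even_two_mul _).mul_left _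
      simp only [Nat.even_mul, Nat.even_add, this, iff_true]
    rw [s1, s2, one_smul] at h1
    have e : (tWeight (f + Finsupp.single x (k + 1)) : ℤ) =
        tWeight (f + Finsupp.single x k) + tw x := by
      rw [Finsupp.single_add, ← add_assoc, map_add, tWeight, weightOf_single]
      push_cast; rfl
    rw [hsucc (k + 1)]
    have h3 := add_mem
      (hF.mono (n := (tWeight (f + Finsupp.single x (k + 1)) : ℤ) - 1) (by linarith) h1)
      (hF.mono (n := (tWeight (f + Finsupp.single x (k + 1)) : ℤ) - 1) (by linarith) h2)
    convert h3 using 1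
    rw [mul_sub, mul_smul_comm, ← hsucc k]
    push_cast
    module

end Independence

end TwistedSuperYangian

namespace TwistedSuperYangian

/-! ### Linear independence and the basis -/

section Basis

variable {M n : ℕ}

/-- The counit; its role is to show that Y(M|N) is not the zero ring. -/
theorem isRTT_trivial {M N : ℕ} :
    IsRTT (M := M) (N := N) (C := ℂ) fun p a b => if p = 0 ∧ a = b then 1 else 0 where
  zero a b := by simp
  comm p q a b c d := by
    rcases p with _ | p <;> rcases q with _ | q <;>
      simp [mul_comm]

instance {M N : ℕ} : Nontrivial (SuperYangian M N) :=
  (lift (isRTT_trivial (M := M) (N := N))).toRingHom.domain_nontrivial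

variable [LinearOrder (PBWLabel M n)]

theorem tWeight_pos {f : PBWLabel M n →₀ ℕ} (hf : tWeight f = 0) : f = 0 := by
  by_contra h
  obtain ⟨x, hx⟩ := Finsupp.support_nonempty_iff.2 h
  have he : f = f - Finsupp.single x 1 + Finsupp.single x 1 :=
    (tsub_add_cancel_of_le (Finsupp.single_le_iff.2
      (Nat.one_le_iff_ne_zero.2 (Finsupp.mem_support_iff.1 hx)))).symm
  rw [he, map_add, tWeight, weightOf_single, tw] at hf
  omega

theorem exists_delL_mon {θ : Fin (M + 2 * n) → ℂ} (hθ : IsTwist θ) (x : PBWLabel M n)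
    {f : PBWLabel M n →₀ ℕ} (hf : IsPBWExp f) (hx : ∀ y ∈ f.support, x ≤ y) (hfx : f x ≠ 0) :
    ∃ ν : ℂ, ν ≠ 0 ∧ delL x (mon θ f) - ν • mon θ (f - Finsupp.single x 1) ∈
      filtT ((tWeight (f - Finsupp.single x 1) : ℤ) - 1) := by
  obtain ⟨k, hk⟩ := Nat.exists_eq_succ_of_ne_zero hfx
  have he : f = f.erase x + Finsupp.single x (k + 1) := by
    rw [← Nat.succ_eq_add_one, ← hk, Finsupp.erase_add_single]
  have he' : f - Finsupp.single x 1 = f.erase x + Finsupp.single x k := by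
    conv_lhs => rw [he, Finsupp.single_add, ← add_assoc, add_tsub_cancel_right]
  have h := delL_mon_add_single hθ x (f.erase x) (fun y hy => by
    rw [Finsupp.support_erase, Finset.mem_erase] at hy
    exact lt_of_le_of_ne (hx y hy.2) hy.1.symm) k (fun hxo => by
      have := hf x hxo; omega)
  rw [← he, ← he'] at h
  exact ⟨_, mul_ne_zero (by exact_mod_cast Nat.succ_ne_zero k)
    (mul_ne_zero (lam_ne_zero x) (by simp)), h⟩

/-- Apply the derivative at the smallest label x that occurs. Monomials without x become negligible;
the others go to nonzero multiples of distinct monomials of weight d - `tw x`, so a nontrivial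
relation survives in smaller weight. -/
theorem mon_independent_mod {θ : Fin (M + 2 * n) → ℂ} (hθ : IsTwist θ) (d : ℕ)
    (s : Finset (PBWLabel M n →₀ ℕ)) (c : (PBWLabel M n →₀ ℕ) → ℂ)
    (hs : ∀ f ∈ s, IsPBWExp f ∧ tWeight f = d)
    (h : ∑ f ∈ s, c f • mon θ f ∈ filtT ((d : ℤ) - 1)) : ∀ f ∈ s, c f = 0 := by
  have hF := isFilt_filtT (M := M) (N := 2 * n)
  induction d using Nat.strong_induction_on generalizing s c with
  | _ d ih =>
    by_contra hcon
    set s1 := s.filter (fun f => c f ≠ 0) with hs1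
    have hsum : ∑ f ∈ s1, c f • mon θ f = ∑ f ∈ s, c f • mon θ f := by
      rw [hs1, Finset.sum_filter_of_ne]
      intro f _ hf h0
      exact hf (by rw [h0, zero_smul])
    rw [← hsum] at h
    have hne : s1.Nonempty := by
      push Not at hcon
      obtain ⟨f, hf, hcf⟩ := hcon
      exact ⟨f, Finset.mem_filter.2 ⟨hf, hcf⟩⟩
    have hs1' : ∀ f ∈ s1, IsPBWExp f ∧ tWeight f = d ∧ c f ≠ 0 := fun f hf =>
      ⟨(hs f (Finset.mem_filter.1 hf).1).1, (hs f (Finset.mem_filter.1 hf).1).2,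
        (Finset.mem_filter.1 hf).2⟩
    obtain ⟨f0, hf0⟩ := hne
    rcases Nat.eq_zero_or_pos d with rfl | hd
    · have hall : s1 = {0} := by
        refine Finset.eq_singleton_iff_unique_mem.2 ⟨?_, fun f hf => tWeight_pos (hs1' f hf).2.1⟩
        rwa [← tWeight_pos (hs1' f0 hf0).2.1]
      -- In weight zero only the empty monomial remains, and the filtration step -1 is zero.
      rw [hall, Finset.sum_singleton, mon_zero, filtT, filt_neg _ _ (by simp),
        Submodule.mem_bot, smul_eq_zero] at h
      refine (hs1' 0 (hall ▸ Finset.mem_singleton_self 0)).2.2 (h.resolve_right one_ne_zero)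
    · have hU : (s1.biUnion Finsupp.support).Nonempty := by
        have : f0 ≠ 0 := by
          rintro rfl
          have := (hs1' 0 hf0).2.1
          simp at this
          omega
        obtain ⟨x, hx⟩ := Finsupp.support_nonempty_iff.2 this
        exact ⟨x, Finset.mem_biUnion.2 ⟨f0, hf0, hx⟩⟩
      -- Minimality puts x leftmost in every monomial where it occurs, so the power rule applies
      -- without reordering.
      set x := (s1.biUnion Finsupp.support).min' hU with hxdef
      have hmin : ∀ f ∈ s1, ∀ y ∈ f.support, x ≤ y := fun f hf y hy =>
        Finset.min'_le _ _ (Finset.mem_biUnion.2 ⟨f, hf, hy⟩)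
      obtain ⟨f1, hf1, hxf1⟩ := Finset.mem_biUnion.1 (Finset.min'_mem _ hU)
      rw [← hxdef, Finsupp.mem_support_iff] at hxf1
      set s2 := s1.filter (fun f => f x ≠ 0) with hs2
      have hν : ∀ f : PBWLabel M n →₀ ℕ, ∃ ν : ℂ, f ∈ s2 → ν ≠ 0 ∧
          delL x (mon θ f) - ν • mon θ (f - Finsupp.single x 1) ∈
            filtT ((tWeight (f - Finsupp.single x 1) : ℤ) - 1) := by
        intro f
        by_cases hf : f ∈ s2
        · obtain ⟨hf', hfx⟩ := Finset.mem_filter.1 hf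
          obtain ⟨ν, h1, h2⟩ := exists_delL_mon hθ x (hs1' f hf').1 (hmin f hf') hfx
          exact ⟨ν, fun _ => ⟨h1, h2⟩⟩
        · exact ⟨0, fun h => absurd h hf⟩
      choose ν hν using hν
      have hsub : ∀ f ∈ s2, f - Finsupp.single x 1 + Finsupp.single x 1 = f := fun f hf =>
        tsub_add_cancel_of_le (Finsupp.single_le_iff.2
          (Nat.one_le_iff_ne_zero.2 (Finset.mem_filter.1 hf).2))
      have hwt : ∀ f ∈ s2, tWeight (f - Finsupp.single x 1) + tw x = d := fun f hf => by
        have := congrArg tWeight (hsub f hf)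
        rw [map_add, (hs1' f (Finset.mem_filter.1 hf).1).2.1] at this
        rw [← this, tWeight, weightOf_single]
      have hf1s : f1 ∈ s2 := Finset.mem_filter.2 ⟨hf1, hxf1⟩
      have hwx : tw x ≤ d := by have := hwt f1 hf1s; omega
      have hmem : ∑ f ∈ s2, (c f * ν f) • mon θ (f - Finsupp.single x 1) ∈
          filtT (((d - tw x : ℕ) : ℤ) - 1) := by
        have e : ((d - tw x : ℕ) : ℤ) - 1 = (d : ℤ) - tw x - 1 := by push_cast [hwx]; ring
        rw [e]
        have h1 : delL x (∑ f ∈ s1, c f • mon θ f) ∈ filtT ((d : ℤ) - tw x - 1) :=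
          hF.mono (by simp only [tw]; push_cast; linarith) (del_mem h (x.p - 1) x.i x.j)
        rw [map_sum, ← Finset.sum_filter_add_sum_filter_not s1 (fun f => f x ≠ 0), ← hs2] at h1
        have h2 : ∑ f ∈ s1.filter (fun f => ¬ f x ≠ 0), delL x (c f • mon θ f) ∈
            filtT ((d : ℤ) - tw x - 1) := by
          refine sum_mem fun f hf => ?_
          obtain ⟨hf', hfx⟩ := Finset.mem_filter.1 hf
          rw [map_smul, ← (hs1' f hf').2.1]
          exact Submodule.smul_mem _ _ (delL_mon_mem hθ x f (not_not.1 hfx))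
        have h3 : ∑ f ∈ s2, (delL x (c f • mon θ f) -
            (c f * ν f) • mon θ (f - Finsupp.single x 1)) ∈ filtT ((d : ℤ) - tw x - 1) := by
          refine sum_mem fun f hf => ?_
          rw [map_smul, mul_smul, ← smul_sub]
          refine Submodule.smul_mem _ _ (hF.mono ?_ (hν f hf).2)
          have := hwt f hf
          omega
        rw [Finset.sum_sub_distrib] at h3
        have := sub_mem (sub_mem h1 h2) h3
        convert this using 1
        abel
      have hinj : Set.InjOn (fun f : PBWLabel M n →₀ ℕ => f - Finsupp.single x 1) s2 := by
        intro f hf g hg hfg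
        rw [← hsub f hf, ← hsub g hg]
        exact congrArg (· + Finsupp.single x 1) hfg
      have key := ih (d - tw x) (by simp only [tw] at hwx ⊢; omega)
        (s2.image fun f => f - Finsupp.single x 1)
        (fun g => c (g + Finsupp.single x 1) * ν (g + Finsupp.single x 1)) ?_ ?_
        (f1 - Finsupp.single x 1) (Finset.mem_image_of_mem _ hf1s)
      · simp only [hsub f1 hf1s] at key
        exact mul_ne_zero (hs1' f1 hf1).2.2 (hν f1 hf1s).1 key
      · intro g hg
        obtain ⟨f, hf, rfl⟩ := Finset.mem_image.1 hg
        refine ⟨fun y hy => ?_, by have := hwt f hf; omega⟩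
        refine le_trans ?_ ((hs1' f (Finset.mem_filter.1 hf).1).1 y hy)
        rw [Finsupp.tsub_apply]
        exact Nat.sub_le _ _
      · rw [Finset.sum_image hinj]
        rw [Finset.sum_congr rfl fun f hf => by rw [hsub f hf]]
        exact hmem

/-- In a genuine relation the top-weight part lies in lower filtration, so its coefficients vanish;
then descend on the weight. -/
theorem linearIndependent_mon {θ : Fin (M + 2 * n) → ℂ} (hθ : IsTwist θ) :
    LinearIndependent ℂ fun f : {f : PBWLabel M n →₀ ℕ // IsPBWExp f} => mon θ f.1 := by
  have hF := isFilt_filtT (M := M) (N := 2 * n)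
  suffices h : ∀ (d : ℕ) (s : Finset (PBWLabel M n →₀ ℕ)) (c : (PBWLabel M n →₀ ℕ) → ℂ),
      (∀ f ∈ s, IsPBWExp f ∧ tWeight f < d) → ∑ f ∈ s, c f • mon θ f = 0 → ∀ f ∈ s, c f = 0 by
    change LinearIndepOn ℂ (mon θ) {f | IsPBWExp f}
    rw [linearIndepOn_iff']
    exact fun s c hs h0 => h (s.sup tWeight + 1) s c
      (fun f hf => ⟨hs hf, Nat.lt_succ_of_le (Finset.le_sup (f := tWeight) hf)⟩) h0
  intro d
  induction d with
  | zero => exact fun s c hs _ f hf => absurd (hs f hf).2 (Nat.not_lt_zero _)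
  | succ d ih =>
    intro s c hs h0
    have hsplit := Finset.sum_filter_add_sum_filter_not s (fun f => tWeight f = d)
      (fun f => c f • mon θ f)
    rw [h0] at hsplit
    have hlow : ∑ f ∈ s.filter (fun f => ¬ tWeight f = d), c f • mon θ f ∈
        filtT ((d : ℤ) - 1) := by
      refine sum_mem fun f hf => Submodule.smul_mem _ _ (hF.mono ?_ (mon_mem_filtT hθ f))
      obtain ⟨hf', hfd⟩ := Finset.mem_filter.1 hf
      have := (hs f hf').2
      omega
    have htop := mon_independent_mod hθ d (s.filter (fun f => tWeight f = d)) c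
      (fun f hf => ⟨(hs f (Finset.mem_filter.1 hf).1).1, (Finset.mem_filter.1 hf).2⟩)
      (by rw [eq_neg_of_add_eq_zero_left hsplit]; exact neg_mem hlow)
    have hrest := ih (s.filter (fun f => ¬ tWeight f = d)) c (fun f hf => by
      obtain ⟨hf', hfd⟩ := Finset.mem_filter.1 hf
      exact ⟨(hs f hf').1, by have := (hs f hf').2; omega⟩) (by
        rwa [Finset.sum_eq_zero fun f hf => by rw [htop f hf, zero_smul], zero_add] at hsplit)
    intro f hf
    by_cases hfd : tWeight f = d
    · exact htop f (Finset.mem_filter.2 ⟨hf, hfd⟩)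
    · exact hrest f (Finset.mem_filter.2 ⟨hf, hfd⟩)

theorem mon_mem_twisted (θ : Fin (M + 2 * n) → ℂ) (f : PBWLabel M n →₀ ℕ) :
    mon θ f ∈ twisted θ :=
  list_prod_mem fun _ hx => by
    obtain ⟨y, -, rfl⟩ := List.mem_map.1 hx
    have : SL θ y ∈ twisted θ := Algebra.subset_adjoin ⟨y.p, y.i, y.j, rfl⟩
    exact pow_mem this _

theorem twisted_le_span {θ : Fin (M + 2 * n) → ℂ} (hθ : IsTwist θ) :
    Subalgebra.toSubmodule (twisted θ) ≤
      Submodule.span ℂ (Set.range fun f : PBWExponent M n => mon θ f.1) := fun x hx => by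
  obtain ⟨k, hk⟩ := exists_mem_filtS hθ hx
  refine Submodule.span_mono ?_ (filtS_le_span hθ k hk)
  rintro _ ⟨f, hf, -, rfl⟩
  exact ⟨⟨f, hf⟩, rfl⟩

end Basis

end TwistedSuperYangian

end

theorem mainTheorem2 (M n : ℕ) (θ : Fin (M + 2 * n) → ℂ)
    (hθ : TwistedSuperYangian.IsTwist θ)
    [LinearOrder (TwistedSuperYangian.PBWLabel M n)] :
    ∃ b : Module.Basis (TwistedSuperYangian.PBWExponent M n) ℂ
        (TwistedSuperYangian.twisted θ),
      ∀ f : TwistedSuperYangian.PBWExponent M n,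
        (b f : TwistedSuperYangian.SuperYangian M (2 * n)) =
          TwistedSuperYangian.orderedMonomial θ f := by
  let v : TwistedSuperYangian.PBWExponent M n → TwistedSuperYangian.twisted θ :=
    fun f => ⟨TwistedSuperYangian.mon θ f.1, TwistedSuperYangian.mon_mem_twisted θ f.1⟩
  have hli : LinearIndependent ℂ v :=
    LinearIndependent.of_comp (TwistedSuperYangian.twisted θ).val.toLinearMap
      (TwistedSuperYangian.linearIndependent_mon hθ)
  have hspan : ⊤ ≤ Submodule.span ℂ (Set.range v) := by
    rintro ⟨x, hx⟩ -
    have h := TwistedSuperYangian.twisted_le_span hθ hx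
    rw [show (Set.range fun f : TwistedSuperYangian.PBWExponent M n =>
        TwistedSuperYangian.mon θ f.1) =
        (TwistedSuperYangian.twisted θ).val.toLinearMap '' Set.range v by
      rw [← Set.range_comp]; rfl, ← Submodule.map_span] at h
    obtain ⟨y, hy, hyx⟩ := h
    rwa [show (⟨x, hx⟩ : TwistedSuperYangian.twisted θ) = y from Subtype.ext hyx.symm]
  refine ⟨Module.Basis.mk hli hspan, fun f => ?_⟩
  rw [Module.Basis.mk_apply]
  rfl
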